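/- Let $n>2$ be even with $n/2$ odd. Let $P_n$ be the path graph on the nodes $1,\dots,n$, with Laplacian matrix $L$ whose eigenvalues are $\lambda_1\le\lambda_2\le\dots\le\lambda_n$. For a symmetric real matrix $A$ let $\lambda_{\min}(A)$ and $\lambda_{\max}(A)$ be its smallest and largest eigenvalues. Let $e_1,\dots,e_n$ be the standard basis of $\mathbb{R}^n$. Put $p_1^*=\frac{n+2}{4}$ and $p_2^*=\frac{3n+2}{4}$, which are integers in $\{1,\dots,n\}$, and $S^*=\{p_1^*,p_2^*\}$. For $p,q\in\{1,\dots,n\}$ (possibly equal) and real $\varepsilon$ put $\lambda_{\min}(\varepsilon;p,q)=\lambda_{\min}(L+\varepsilon e_pe_p^T+\varepsilon e_qe_q^T)$. Then the following hold. 1. There are real numbers $\beta(p,q)$ such that for all $p,q\in\{1,\dots,n\}$, as $\varepsilon\to0$, $$\lambda_{\min}(\varepsilon;p,q)=\frac{2\varepsilon}{n}+\beta(p,q)\,\varepsilon^2+O(\varepsilon^3),$$ and $\beta(p,q)<\beta(p_1^*,p_2^*)$ whenever $\{p,q\}\neq\{p_1^*,p_2^*\}$. The maximal coefficient is $$\beta(p_1^*,p_2^*)=-\frac{n^2-4}{12n^2}=-\frac{1}{4n}\sum_{j=2}^{n}\frac{\bigl\{\cos\bigl(\tfrac{\pi(j-1)}{4}\bigr)+\cos\bigl(\tfrac{3\pi(j-1)}{4}\bigr)\bigr\}^2}{\sin^2\bigl(\tfrac{\pi(j-1)}{2n}\bigr)\,\sum_{p=1}^{n}\cos^2\bigl(\tfrac{\pi(j-1)(p-1/2)}{n}\bigr)}.$$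 Moreover, for every sufficiently small real $\varepsilon\neq0$, $\lambda_{\min}(\varepsilon;p,q)<\lambda_{\min}(\varepsilon;p_1^*,p_2^*)$ whenever $\{p,q\}\neq\{p_1^*,p_2^*\}$. 2. The set $S^*$ is the unique 2-center of $P_n$ in each of the following three senses, where $\Delta$ is the maximum degree of $P_n$, $Z=I-\tau L$ with $0<\tau<1/\Delta$, and $S$ ranges over all subsets of $\{1,\dots,n\}$ with $|S|=2$: - (MPLSE) for every sufficiently small real $\varepsilon\ne0$ (in particular for all small $\varepsilon>0$), $S^*$ is the unique maximizer of $\lambda_{\min}\bigl(L-\varepsilon\sum_{j\in S}e_je_j^T\bigr)$; - (MSub-LE) for every such $\tau$, $S^*$ is the unique minimizer of $\lambda_{\max}$ of the principal submatrix of $Z$ obtained by removing the rows and columns indexed by $S$; - (MSup-LE) for every such $\tau$ and every sufficiently small $\varepsilon>0$ (depending on $\tau$ and $n$), $S^*$ is the unique minimizer of $\lambda_{\max}\bigl(Z+\varepsilon\sum_{j\in S}e_je_j^T\bigr)$. 3. If $v\neq0$ is an eigenvector of $L$ for $\lambda_3$, then for every $j\in\{1,\dots,n\}$, $v(j)=0$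 if and only if $j\in\{p_1^*,p_2^*\}$. -/

import Mathlib

open Filter Topology Asymptotics

noncomputable section

namespace KCenter

section Eigenvalues

variable {V : Type*} [Fintype V] [DecidableEq V]

/-- The smallest eigenvalue of a (nonempty, symmetric) real matrix. -/
def lambdaMin (A : Matrix V V ℝ) : ℝ := sInf (spectrum ℝ A)

/-- The largest eigenvalue of a (nonempty, symmetric) real matrix. -/
def lambdaMax (A : Matrix V V ℝ) : ℝ := sSup (spectrum ℝ A)

/-- The eigenvalues of a symmetric real matrix in increasing order, with multiplicity:
index `0` is the smallest one, so `λ_{k+1}` is the value at `k`. -/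
def eigenvalueAsc {A : Matrix V V ℝ} (hA : A.IsHermitian) (k : Fin (Fintype.card V)) : ℝ :=
  hA.eigenvalues₀ k.rev

theorem eigenvalueAsc_monotone {A : Matrix V V ℝ} (hA : A.IsHermitian) :
    Monotone (eigenvalueAsc hA) := fun _ _ h =>
  hA.eigenvalues₀_antitone (Fin.rev_le_rev.mpr h)

theorem lambdaMin_isLeast [Nonempty V] {A : Matrix V V ℝ} (hA : A.IsHermitian) :
    IsLeast (spectrum ℝ A) (lambdaMin A) := by
  have h := hA.spectrum_real_eq_range_eigenvalues
  have hne : (spectrum ℝ A).Nonempty := h ▸ Set.range_nonempty _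
  have hfin : (spectrum ℝ A).Finite := h ▸ Set.finite_range _
  exact ⟨hne.csInf_mem hfin, fun x hx => csInf_le hfin.bddBelow hx⟩

theorem lambdaMax_isGreatest [Nonempty V] {A : Matrix V V ℝ} (hA : A.IsHermitian) :
    IsGreatest (spectrum ℝ A) (lambdaMax A) := by
  have h := hA.spectrum_real_eq_range_eigenvalues
  have hne : (spectrum ℝ A).Nonempty := h ▸ Set.range_nonempty _
  have hfin : (spectrum ℝ A).Finite := h ▸ Set.finite_range _
  exact ⟨hne.csSup_mem hfin, fun x hx => le_csSup hfin.bddAbove hx⟩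

end Eigenvalues

section Centers

variable {V : Type*} [Fintype V] [DecidableEq V]

/-- The rank-one matrix `e_j e_jᵀ`. -/
def unitDiag (j : V) : Matrix V V ℝ := Matrix.vecMulVec (Pi.single j 1) (Pi.single j 1)

variable (G : SimpleGraph V) [DecidableRel G.Adj]

/-- `Z = I - τ L`. -/
def stochasticMatrix (τ : ℝ) : Matrix V V ℝ := 1 - τ • G.lapMatrix ℝ

/-- `L - ε ∑_{j ∈ S} e_j e_jᵀ`. -/
def perturbedLaplacian (ε : ℝ) (S : Finset V) : Matrix V V ℝ :=
  G.lapMatrix ℝ - ε • ∑ j ∈ S, unitDiag j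

/-- `Z + ε ∑_{j ∈ S} e_j e_jᵀ`. -/
def superStochastic (τ ε : ℝ) (S : Finset V) : Matrix V V ℝ :=
  stochasticMatrix G τ + ε • ∑ j ∈ S, unitDiag j

/-- The principal submatrix of `Z` obtained by removing the rows and columns in `S`. -/
def subStochastic (τ : ℝ) (S : Finset V) : Matrix {i : V // i ∉ S} {i : V // i ∉ S} ℝ :=
  (stochasticMatrix G τ).submatrix Subtype.val Subtype.val

/-- The `k`-subsets `S` maximizing the smallest eigenvalue of `L - ε ∑_{j ∈ S} e_j e_jᵀ`. -/
def argmaxMPLSE (k : ℕ) (ε : ℝ) : Set (Finset V) :=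
  {S | S.card = k ∧ ∀ T : Finset V, T.card = k →
    lambdaMin (perturbedLaplacian G ε T) ≤ lambdaMin (perturbedLaplacian G ε S)}

/-- The `k`-subsets `S` minimizing the largest eigenvalue of the principal submatrix of `Z`
with the rows and columns in `S` removed. -/
def argminMSubLE (k : ℕ) (τ : ℝ) : Set (Finset V) :=
  {S | S.card = k ∧ ∀ T : Finset V, T.card = k →
    lambdaMax (subStochastic G τ S) ≤ lambdaMax (subStochastic G τ T)}

/-- The `k`-subsets `S` minimizing the largest eigenvalue of `Z + ε ∑_{j ∈ S} e_j e_jᵀ`. -/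
def argminMSupLE (k : ℕ) (τ ε : ℝ) : Set (Finset V) :=
  {S | S.card = k ∧ ∀ T : Finset V, T.card = k →
    lambdaMax (superStochastic G τ ε S) ≤ lambdaMax (superStochastic G τ ε T)}

end Centers

section TwoPorts

/-- The smallest eigenvalue of `L + ε e_p e_pᵀ + ε e_q e_qᵀ`, where `L` is the Laplacian of the
path graph on `n` nodes. -/
def twoPortLambdaMin (n : ℕ) [DecidableRel (SimpleGraph.pathGraph n).Adj] (p q : Fin n)
    (ε : ℝ) : ℝ :=
  lambdaMin ((SimpleGraph.pathGraph n).lapMatrix ℝ + ε • unitDiag p + ε • unitDiag q)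

end TwoPorts

end KCenter

end

/-! Index nodes from 0 and write n = 4a + 2, so the center is {a, 3a + 1}.

Expansion. Let w count the two perturbed nodes. The charge r = 2/n - w is neutral, so `L F = r` is
solvable, and β is the constant making r F + β neutral, so `L G = r F + β` is solvable too. Then 1 +
εF + ε²G is positive for small ε and solves the eigenvalue equation with 2ε/n + βε² up to O(ε³);
positive sub- and supersolutions turn this into bounds on the smallest eigenvalue
(`twoPortLambdaMin_isBigO`). Summation by parts shows that -nβ is the sum of the squared partial
sums of r.

Maximality. After scaling by 2a + 1, each partial sum is l + 1 minus an integer multiple of 2a + 1.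
The center picks the nearest multiple for every l, so it minimizes each square separately, and any
other pair is strictly worse for some l (`twoPortCoeff_lt`). Expanding r and F in the cosine
eigenvectors gives the trigonometric form of β.

Centers. MPLSE is the same comparison at -ε, and MSup-LE reduces to MPLSE at ε/τ. For MSub-LE,
grounding p < q cuts the path into segments whose ground values are 2 - 2cos(π/y) with y = 2p + 1, q
- p and 2b + 1, where b nodes lie beyond q. The center makes all three y equal to 2a + 1, and every
other pair makes some y larger. The third eigenvector is a multiple of a cosine with explicit zeros.
-/

noncomputable section

namespace KCenter

/-! ### Extremal eigenvalues: comparison principles and enumeration -/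

section Spectral

variable {V : Type*} [Fintype V] [DecidableEq V]

theorem mem_spectrum_iff_exists_mulVec {A : Matrix V V ℝ} {μ : ℝ} :
    μ ∈ spectrum ℝ A ↔ ∃ v : V → ℝ, v ≠ 0 ∧ A.mulVec v = μ • v := by
  rw [← Matrix.spectrum_toLin', ← Module.End.hasEigenvalue_iff_mem_spectrum]
  constructor
  · intro h
    obtain ⟨v, hv⟩ := h.exists_hasEigenvector
    exact ⟨v, hv.2, by simpa using hv.apply_eq_smul⟩
  · rintro ⟨v, hv, h⟩
    exact Module.End.hasEigenvalue_of_hasEigenvector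
      ⟨Module.End.mem_eigenspace_iff.2 (by simpa using h), hv⟩

/-- A positive supersolution of a matrix with nonnegative off-diagonal entries bounds all real
eigenvalues from above. -/
theorem eigenvalue_le_of_pos_supersolution {A : Matrix V V ℝ} (hA : ∀ i j, i ≠ j → 0 ≤ A i j)
    {x : V → ℝ} (hx : ∀ i, 0 < x i) {ρ : ℝ} (hρ : ∀ i, A.mulVec x i ≤ ρ * x i) {μ : ℝ}
    (hμ : μ ∈ spectrum ℝ A) : μ ≤ ρ := by
  obtain ⟨v, hv, h⟩ := mem_spectrum_iff_exists_mulVec.1 hμ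
  obtain ⟨i₁, hi₁⟩ := Function.ne_iff.1 hv
  -- the extremal ratio, for an eigenvector normalized in sign
  have key : ∀ v : V → ℝ, A.mulVec v = μ • v → ∀ i, 0 < v i →
      (∀ j, v j / x j ≤ v i / x i) → μ ≤ ρ := by
    intro v h i hi hmax
    set t := v i / x i with ht
    have htpos : 0 < t := div_pos hi (hx i)
    have hvi : v i = t * x i := by rw [ht, div_mul_cancel₀ _ (hx i).ne']
    -- The vector t • x dominates v and touches it at i, so only off-diagonal entries, which are
    -- nonnegative, contribute to the difference.
    have h1 : A.mulVec v i ≤ A.mulVec (t • x) i := by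
      simp only [Matrix.mulVec, dotProduct, Pi.smul_apply, smul_eq_mul]
      refine Finset.sum_le_sum fun j _ => ?_
      by_cases hij : i = j
      · subst hij; rw [hvi]
      · exact mul_le_mul_of_nonneg_left ((div_le_iff₀ (hx j)).1 (hmax j)) (hA i j hij)
    rw [h, Matrix.mulVec_smul] at h1
    simp only [Pi.smul_apply, smul_eq_mul] at h1
    have h2 := mul_le_mul_of_nonneg_left (hρ i) htpos.le
    rw [hvi] at h1
    have h3 : μ * (t * x i) ≤ ρ * (t * x i) := by linarith
    exact le_of_mul_le_mul_right h3 (mul_pos htpos (hx i))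
  have : Nonempty V := ⟨i₁⟩
  obtain ⟨i, hi⟩ := Finite.exists_max fun j => |v j / x j|
  have hne : v i / x i ≠ 0 := by
    intro h0
    have := hi i₁
    rw [h0, abs_zero] at this
    exact div_ne_zero hi₁ (hx i₁).ne' (abs_eq_zero.1 (le_antisymm this (abs_nonneg _)))
  rcases lt_or_gt_of_ne hne with hneg | hpos
  · refine key (-v) (by rw [Matrix.mulVec_neg, h, smul_neg]) i ?_ fun j => ?_
    · have := (div_lt_iff₀ (hx i)).1 hneg
      simp only [Pi.neg_apply]; linarith
    · have := hi j
      rw [abs_of_neg hneg] at this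
      simpa only [Pi.neg_apply, neg_div] using (neg_le_abs _).trans this
  · refine key v h i ?_ fun j => ?_
    · have := (lt_div_iff₀ (hx i)).1 hpos
      linarith
    · have := hi j
      rw [abs_of_pos hpos] at this
      exact (le_abs_self _).trans this

theorem neg_mem_spectrum_neg {A : Matrix V V ℝ} {μ : ℝ} (h : μ ∈ spectrum ℝ A) :
    -μ ∈ spectrum ℝ (-A) := by
  obtain ⟨v, hv, h⟩ := mem_spectrum_iff_exists_mulVec.1 h
  exact mem_spectrum_iff_exists_mulVec.2 ⟨v, hv, by rw [Matrix.neg_mulVec, h, neg_smul]⟩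

/-- A positive subsolution of a symmetric matrix with nonpositive off-diagonal entries bounds its
smallest eigenvalue from below. -/
theorem le_lambdaMin_of_pos_subsolution [Nonempty V] {A : Matrix V V ℝ} (hH : A.IsHermitian)
    (hA : ∀ i j, i ≠ j → A i j ≤ 0)
    {x : V → ℝ} (hx : ∀ i, 0 < x i) {ρ : ℝ} (hρ : ∀ i, ρ * x i ≤ A.mulVec x i) :
    ρ ≤ lambdaMin A := by
  have := eigenvalue_le_of_pos_supersolution (A := -A) (x := x) (ρ := -ρ)
    (fun i j hij => by simpa using hA i j hij) hx
    (fun i => by simpa [Matrix.neg_mulVec] using hρ i)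
    (neg_mem_spectrum_neg (lambdaMin_isLeast hH).1)
  linarith

/-- Subtracting `lambdaMin A` times the identity leaves no negative eigenvalue, hence a positive
semidefinite matrix. -/
theorem lambdaMin_mul_dotProduct_le [Nonempty V] {A : Matrix V V ℝ} (hH : A.IsHermitian)
    (x : V → ℝ) : lambdaMin A * (x ⬝ᵥ x) ≤ x ⬝ᵥ A.mulVec x := by
  have hB : (A - lambdaMin A • (1 : Matrix V V ℝ)).IsHermitian := by
    refine hH.sub ?_
    rw [Matrix.IsHermitian, Matrix.conjTranspose_smul, Matrix.conjTranspose_one]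
    simp
  have hpsd : (A - lambdaMin A • (1 : Matrix V V ℝ)).PosSemidef := by
    rw [hB.posSemidef_iff_eigenvalues_nonneg]
    intro i
    have hmem : hB.eigenvalues i ∈ spectrum ℝ (A - lambdaMin A • (1 : Matrix V V ℝ)) := by
      rw [hB.spectrum_real_eq_range_eigenvalues]; exact ⟨i, rfl⟩
    obtain ⟨v, hv, h⟩ := mem_spectrum_iff_exists_mulVec.1 hmem
    rw [Matrix.sub_mulVec, Matrix.smul_mulVec, Matrix.one_mulVec, sub_eq_iff_eq_add,
      ← add_smul] at h
    have := (lambdaMin_isLeast hH).2 (mem_spectrum_iff_exists_mulVec.2 ⟨v, hv, h⟩)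
    simp only [Pi.zero_apply]
    linarith
  have := (Matrix.posSemidef_iff_dotProduct_mulVec.1 hpsd).2 x
  rw [Matrix.sub_mulVec, Matrix.smul_mulVec, Matrix.one_mulVec, dotProduct_sub,
    dotProduct_smul] at this
  simp only [star_trivial, smul_eq_mul] at this
  linarith

/-- A positive supersolution of a symmetric matrix bounds its smallest eigenvalue from above. -/
theorem lambdaMin_le_of_pos_supersolution [Nonempty V] {A : Matrix V V ℝ} (hH : A.IsHermitian)
    {x : V → ℝ} (hx : ∀ i, 0 < x i) {ρ : ℝ} (hρ : ∀ i, A.mulVec x i ≤ ρ * x i) :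
    lambdaMin A ≤ ρ := by
  have h1 := lambdaMin_mul_dotProduct_le hH x
  have h2 : x ⬝ᵥ A.mulVec x ≤ ρ * (x ⬝ᵥ x) := by
    rw [dotProduct, dotProduct, Finset.mul_sum]
    refine Finset.sum_le_sum fun i _ => ?_
    have := mul_le_mul_of_nonneg_left (hρ i) (hx i).le
    linarith
  have h3 : 0 < x ⬝ᵥ x :=
    Finset.sum_pos (fun i _ => mul_pos (hx i) (hx i)) Finset.univ_nonempty
  exact le_of_mul_le_mul_right (h1.trans h2) h3

theorem lambdaMax_one_sub_smul [Nonempty V] {A : Matrix V V ℝ} (hH : A.IsHermitian) {τ : ℝ}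
    (hτ : 0 < τ) : lambdaMax (1 - τ • A) = 1 - τ * lambdaMin A := by
  have hl := lambdaMin_isLeast hH
  have hg : IsGreatest (spectrum ℝ (1 - τ • A)) (1 - τ * lambdaMin A) := by
    constructor
    · obtain ⟨v, hv, h⟩ := mem_spectrum_iff_exists_mulVec.1 hl.1
      refine mem_spectrum_iff_exists_mulVec.2 ⟨v, hv, ?_⟩
      rw [Matrix.sub_mulVec, Matrix.smul_mulVec, Matrix.one_mulVec, h, sub_smul, one_smul,
        mul_smul]
    · intro μ hμ
      obtain ⟨v, hv, h⟩ := mem_spectrum_iff_exists_mulVec.1 hμ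
      have h2 : A.mulVec v = ((1 - μ) / τ) • v := by
        rw [Matrix.sub_mulVec, Matrix.smul_mulVec, Matrix.one_mulVec] at h
        funext i
        have := congrFun h i
        simp only [Pi.sub_apply, Pi.smul_apply, smul_eq_mul] at this ⊢
        field_simp
        linarith
      have := hl.2 (mem_spectrum_iff_exists_mulVec.2 ⟨v, hv, h2⟩)
      rw [le_div_iff₀ hτ] at this
      linarith
  exact hg.csSup_eq

/-- The entry `⟨k, _⟩` of the increasing enumeration of the eigenvalues, when these are given as a
strictly increasing family. -/
theorem eigenvalueAsc_eq_of_strictMono {A : Matrix V V ℝ} (hA : A.IsHermitian)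
    (μ : Fin (Fintype.card V) → ℝ) (hμ : StrictMono μ) (hmem : ∀ k, μ k ∈ spectrum ℝ A) :
    eigenvalueAsc hA = μ := by
  have hrange : Set.range (eigenvalueAsc hA) = spectrum ℝ A := by
    rw [hA.spectrum_real_eq_range_eigenvalues]
    ext y
    constructor
    · rintro ⟨k, rfl⟩
      exact ⟨Fintype.equivOfCardEq (Fintype.card_fin _) k.rev, by
        simp [Matrix.IsHermitian.eigenvalues, eigenvalueAsc]⟩
    · rintro ⟨k, rfl⟩
      exact ⟨((Fintype.equivOfCardEq (Fintype.card_fin _)).symm k).rev, by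
        simp [Matrix.IsHermitian.eigenvalues, eigenvalueAsc]⟩
  have hsub : Finset.univ.image μ ⊆ Finset.univ.image (eigenvalueAsc hA) := by
    intro y hy
    obtain ⟨k, -, rfl⟩ := Finset.mem_image.1 hy
    obtain ⟨l, hl⟩ := hrange.symm ▸ hmem k
    exact Finset.mem_image.2 ⟨l, Finset.mem_univ _, hl⟩
  -- The distinct values of μ already fill the range of the enumeration, which is therefore
  -- injective; two strictly increasing families with the same range coincide.
  have hcard : (Finset.univ.image μ).card = Fintype.card V := by
    rw [Finset.card_image_of_injective _ hμ.injective, Finset.card_univ, Fintype.card_fin]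
  have hle : (Finset.univ.image (eigenvalueAsc hA)).card ≤ Fintype.card V :=
    Finset.card_image_le.trans (by simp)
  have heq := Finset.eq_of_subset_of_card_le hsub (hle.trans hcard.ge)
  have hinj : Function.Injective (eigenvalueAsc hA) := by
    have : (Finset.univ.image (eigenvalueAsc hA)).card =
        (Finset.univ : Finset (Fin (Fintype.card V))).card := by
      rw [← heq, hcard, Finset.card_univ, Fintype.card_fin]
    simpa using Finset.injOn_of_card_image_eq this
  have hsm : StrictMono (eigenvalueAsc hA) := (eigenvalueAsc_monotone hA).strictMono_of_injective hinj
  refine (hsm.range_inj hμ).1 ?_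
  have := congrArg (fun s : Finset ℝ => (s : Set ℝ)) heq
  simpa using this.symm

theorem setOf_card_forall_le_eq_singleton {α : Type*} {k : ℕ} {F : Finset α → ℝ} {S₀ : Finset α}
    (h₀ : S₀.card = k) (h : ∀ S : Finset α, S.card = k → S ≠ S₀ → F S₀ < F S) :
    {S | S.card = k ∧ ∀ T : Finset α, T.card = k → F S ≤ F T} = {S₀} := by
  ext S
  simp only [Set.mem_ofPred_eq, Set.mem_singleton_iff]
  constructor
  · rintro ⟨hS, hmin⟩
    by_contra hne
    exact absurd (hmin S₀ h₀) (not_le.2 (h S hS hne))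
  · rintro rfl
    refine ⟨h₀, fun T hT => ?_⟩
    rcases eq_or_ne T S with rfl | hne
    · exact le_rfl
    · exact (h T hT hne).le

end Spectral

/-! ### The path Laplacian as a second difference, and its Poisson equation -/

section PathLaplacian

variable {n : ℕ} [DecidableRel (SimpleGraph.pathGraph n).Adj]

/-- Taking φ on ℤ avoids truncated subtraction and provides ghost values at -1 and n, through which
the end conditions are later expressed. -/
theorem pathGraph_lapMatrix_mulVec (φ : ℤ → ℝ) (i : Fin n) :
    ((SimpleGraph.pathGraph n).lapMatrix ℝ).mulVec (fun j => φ (j : ℕ)) i =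
      (if (i : ℕ) + 1 < n then φ (i : ℕ) - φ ((i : ℕ) + 1) else 0) +
        (if 0 < (i : ℕ) then φ (i : ℕ) - φ ((i : ℕ) - 1) else 0) := by
  have h1 : ((SimpleGraph.pathGraph n).lapMatrix ℝ).mulVec (fun j => φ (j : ℕ)) i =
      ∑ j : Fin n, if (SimpleGraph.pathGraph n).Adj i j then φ (i : ℕ) - φ (j : ℕ) else 0 := by
    rw [SimpleGraph.lapMatrix_mulVec_apply, ← Finset.sum_filter,
      ← SimpleGraph.neighborFinset_eq_filter, Finset.sum_sub_distrib, Finset.sum_const,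
      SimpleGraph.card_neighborFinset_eq_degree, nsmul_eq_mul]
  have h2 : ∀ j : Fin n,
      (if (SimpleGraph.pathGraph n).Adj i j then φ (i : ℕ) - φ (j : ℕ) else 0) =
      (if (i : ℕ) + 1 = j then φ (i : ℕ) - φ (j : ℕ) else 0) +
        (if (j : ℕ) + 1 = i then φ (i : ℕ) - φ (j : ℕ) else 0) := by
    intro j
    rw [if_congr SimpleGraph.pathGraph_adj rfl rfl]
    split_ifs <;> first | omega | simp
  rw [h1, Finset.sum_congr rfl fun j _ => h2 j, Finset.sum_add_distrib]
  congr 1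
  · split_ifs with h
    · rw [Finset.sum_eq_single (⟨i + 1, h⟩ : Fin n)]
      · simp
      · intro j _ hj
        exact if_neg fun h' => hj (Fin.ext h'.symm)
      · simp
    · exact Finset.sum_eq_zero fun j _ => if_neg fun h' => h (by have := j.2; omega)
  · split_ifs with h
    · rw [Finset.sum_eq_single (⟨i - 1, by omega⟩ : Fin n)]
      · have h3 : (i : ℕ) - 1 + 1 = i := by omega
        have h4 : (((i : ℕ) - 1 : ℕ) : ℤ) = (i : ℕ) - 1 := by omega
        simp only [h3, h4, if_true]
      · intro j _ hj
        exact if_neg fun h' => hj (Fin.ext (by simp only; omega))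
      · simp
    · exact Finset.sum_eq_zero fun j _ => if_neg fun h' => h (by omega)

/-- The Laplacian of the path as a second difference, away from the ends or where the Neumann
condition holds at them. -/
theorem pathGraph_lapMatrix_mulVec_eq (φ : ℤ → ℝ) (i : Fin n)
    (h0 : (i : ℕ) = 0 → φ (-1) = φ 0) (h1 : (i : ℕ) + 1 = n → φ n = φ ((n : ℤ) - 1)) :
    ((SimpleGraph.pathGraph n).lapMatrix ℝ).mulVec (fun j => φ (j : ℕ)) i =
      2 * φ (i : ℕ) - φ ((i : ℕ) + 1) - φ ((i : ℕ) - 1) := by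
  rw [pathGraph_lapMatrix_mulVec]
  have e0 : (if 0 < (i : ℕ) then φ (i : ℕ) - φ ((i : ℕ) - 1) else 0) =
      φ (i : ℕ) - φ ((i : ℕ) - 1) := by
    split_ifs with h
    · rfl
    · have h' : (i : ℕ) = 0 := by omega
      have := h0 h'
      rw [h']; simp [this]
  have e1 : (if (i : ℕ) + 1 < n then φ (i : ℕ) - φ ((i : ℕ) + 1) else 0) =
      φ (i : ℕ) - φ ((i : ℕ) + 1) := by
    split_ifs with h
    · rfl
    · have h' : (i : ℕ) + 1 = n := by omega
      have h2 := h1 h'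
      have h3 : ((i : ℕ) : ℤ) = (n : ℤ) - 1 := by omega
      rw [h3, sub_add_cancel, h2, sub_self]
  rw [e0, e1]; ring

/-- The potential of a charge distribution on the path: the negative of its iterated partial
sums. -/
def pathPotential (r : ℕ → ℝ) (i : ℕ) : ℝ :=
  -∑ l ∈ Finset.range i, ∑ j ∈ Finset.range (l + 1), r j

theorem pathPotential_succ (r : ℕ → ℝ) (i : ℕ) :
    pathPotential r (i + 1) = pathPotential r i - ∑ j ∈ Finset.range (i + 1), r j := by
  rw [pathPotential, pathPotential, Finset.sum_range_succ]; ring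

/-- The drop of the potential across an edge is the total charge to its left, so its divergence is
r. Neutrality is what closes the equation at the right end. -/
theorem lapMatrix_mulVec_pathPotential (r : ℕ → ℝ) (hr : ∑ j ∈ Finset.range n, r j = 0)
    (i : Fin n) :
    ((SimpleGraph.pathGraph n).lapMatrix ℝ).mulVec (fun j => pathPotential r j) i = r i := by
  have := pathGraph_lapMatrix_mulVec (fun k => pathPotential r k.toNat) i
  simp only [Int.toNat_natCast] at this
  rw [this]
  have e1 : ((i : ℕ) + 1 : ℤ).toNat = i + 1 := by omega
  rw [e1, pathPotential_succ]
  rcases Nat.eq_zero_or_pos (i : ℕ) with h0 | h0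
  · rw [h0, if_neg (lt_irrefl 0)]
    split_ifs with h
    · simp
    · have hn : n = 1 := by have := i.2; omega
      subst hn
      simpa using hr.symm
  · obtain ⟨k, hk⟩ := Nat.exists_eq_succ_of_ne_zero h0.ne'
    have e2 : (((i : ℕ) : ℤ) - 1).toNat = k := by omega
    rw [if_pos h0, e2, hk, Nat.succ_eq_add_one, pathPotential_succ, Finset.sum_range_succ _ (k + 1)]
    split_ifs with h
    · ring
    · have hn : n = k + 1 + 1 := by have := i.2; omega
      rw [hn, Finset.sum_range_succ] at hr
      linarith

/-- Summation by parts. For a neutral charge the boundary term vanishes and the energy becomes a sum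
of squared edge flows. -/
theorem sum_mul_pathPotential (r : ℕ → ℝ) (N : ℕ) :
    ∑ i ∈ Finset.range N, r i * pathPotential r i =
      (∑ j ∈ Finset.range N, r j) * pathPotential r N +
        ∑ l ∈ Finset.range N, (∑ j ∈ Finset.range (l + 1), r j) ^ 2 := by
  induction N with
  | zero => simp
  | succ N ih =>
    rw [Finset.sum_range_succ, ih, pathPotential_succ,
      Finset.sum_range_succ (fun l => (∑ j ∈ Finset.range (l + 1), r j) ^ 2) N,
      Finset.sum_range_succ r N]
    ring

end PathLaplacian

/-! ### Second-order expansion of the smallest eigenvalue -/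

section Expansion

variable {V : Type*} [Fintype V] [DecidableEq V]

theorem unitDiag_mulVec_apply (p : V) (v : V → ℝ) (i : V) :
    (unitDiag p).mulVec v i = (if i = p then 1 else 0) * v i := by
  rw [unitDiag, Matrix.vecMulVec_mulVec]
  by_cases h : i = p
  · subst h; simp
  · simp [h]

omit [Fintype V] in
theorem unitDiag_isHermitian (p : V) : (unitDiag p).IsHermitian := by
  ext i j
  simp [unitDiag, Matrix.vecMulVec_apply, mul_comm]

omit [Fintype V] in
theorem unitDiag_apply_of_ne (p : V) {i j : V} (h : i ≠ j) : unitDiag p i j = 0 := by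
  rw [unitDiag, Matrix.vecMulVec_apply]
  by_cases hi : i = p
  · subst hi; simp [h.symm]
  · simp [hi]

theorem lapMatrix_apply_of_ne_nonpos (G : SimpleGraph V) [DecidableRel G.Adj] {i j : V}
    (h : i ≠ j) : G.lapMatrix ℝ i j ≤ 0 := by
  rw [SimpleGraph.lapMatrix, Matrix.sub_apply, SimpleGraph.degMatrix, Matrix.diagonal_apply_ne _ h,
    SimpleGraph.adjMatrix_apply]
  split_ifs <;> simp

variable {n : ℕ} [DecidableRel (SimpleGraph.pathGraph n).Adj]

theorem twoPort_isHermitian (p q : Fin n) (ε : ℝ) :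
    ((SimpleGraph.pathGraph n).lapMatrix ℝ + ε • unitDiag p + ε • unitDiag q).IsHermitian :=
  ((SimpleGraph.isHermitian_lapMatrix ℝ _).add ((unitDiag_isHermitian p).smul (IsSelfAdjoint.all ε))).add
    ((unitDiag_isHermitian q).smul (IsSelfAdjoint.all ε))

/-- The second-order coefficient of the smallest eigenvalue of the path Laplacian perturbed at two
nodes. -/
def twoPortCoeff (n p q : ℕ) : ℝ :=
  -(1 / (n : ℝ)) * ∑ l ∈ Finset.range n,
    (2 * ((l : ℝ) + 1) / n - (if p ≤ l then 1 else 0) - (if q ≤ l then 1 else 0)) ^ 2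

/-- The charge distribution that is uniform except for unit sinks at `p` and `q`. -/
def twoPortCharge (n p q : ℕ) (i : ℕ) : ℝ :=
  2 / n - ((if i = p then 1 else 0) + (if i = q then 1 else 0))

theorem sum_twoPortCharge (n p q N : ℕ) :
    ∑ j ∈ Finset.range (N + 1), twoPortCharge n p q j =
      2 * ((N : ℝ) + 1) / n - (if p ≤ N then 1 else 0) - (if q ≤ N then 1 else 0) := by
  simp only [twoPortCharge, Finset.sum_sub_distrib, Finset.sum_add_distrib, Finset.sum_const,
    Finset.card_range, nsmul_eq_mul, Finset.sum_ite_eq', Finset.mem_range, Nat.lt_succ_iff,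
    Nat.cast_add, Nat.cast_one]
  ring

theorem sum_range_twoPortCharge (p q : Fin n) :
    ∑ j ∈ Finset.range n, twoPortCharge n p q j = 0 := by
  obtain ⟨N, rfl⟩ : ∃ N, n = N + 1 := ⟨n - 1, by have := p.2; omega⟩
  rw [sum_twoPortCharge, if_pos (by omega), if_pos (by omega)]
  have : ((N : ℝ) + 1) ≠ 0 := by positivity
  push_cast
  field_simp
  norm_num

theorem sum_twoPortCharge_mul_potential (p q : Fin n) :
    ∑ i ∈ Finset.range n, twoPortCharge n p q i * pathPotential (twoPortCharge n p q) i =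
      -(n * twoPortCoeff n p q) := by
  rw [sum_mul_pathPotential, sum_range_twoPortCharge, zero_mul, zero_add, twoPortCoeff]
  simp only [sum_twoPortCharge]
  have : (n : ℝ) ≠ 0 := by have := p.2; exact_mod_cast (by omega : n ≠ 0)
  field_simp

/-- A truncated perturbation series near the constant vector stays positive, so the comparison
principles apply to it directly and no analytic perturbation theory is needed. -/
theorem twoPortLambdaMin_isBigO (p q : Fin n) :
    (fun ε : ℝ => twoPortLambdaMin n p q ε - (2 * ε / n + twoPortCoeff n p q * ε ^ 2))
      =O[𝓝 0] (fun ε : ℝ => ε ^ 3) := by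
  have hne : Nonempty (Fin n) := ⟨p⟩
  set β := twoPortCoeff n p q with hβ
  set r := twoPortCharge n p q with hr
  set F := pathPotential r with hF
  -- The source of the second-order equation; β is exactly the constant that makes it neutral.
  set s : ℕ → ℝ := fun i => r i * F i + β with hs
  set G := pathPotential s with hG
  have hs0 : ∑ j ∈ Finset.range n, s j = 0 := by
    simp only [hs, Finset.sum_add_distrib, Finset.sum_const, Finset.card_range, nsmul_eq_mul]
    rw [hF, hr, sum_twoPortCharge_mul_potential]
    ring
  have hLF := lapMatrix_mulVec_pathPotential (n := n) r (sum_range_twoPortCharge p q)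
  have hLG := lapMatrix_mulVec_pathPotential (n := n) s hs0
  set w : ℕ → ℝ := fun i => (if i = p then 1 else 0) + (if i = q then 1 else 0) with hw
  have hrw : ∀ i, r i = 2 / n - w i := fun i => rfl
  let x : ℝ → Fin n → ℝ := fun ε i => 1 + ε * F i + ε ^ 2 * G i
  -- What remains of the eigenvalue equation for `x ε`, divided by ε³.
  let h : ℝ → Fin n → ℝ := fun ε i => -(r i * G i) - β * F i - ε * (β * G i)
  have hres : ∀ ε i, ((SimpleGraph.pathGraph n).lapMatrix ℝ + ε • unitDiag p +
      ε • unitDiag q).mulVec (x ε) i =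
      (2 * ε / n + β * ε ^ 2) * x ε i + ε ^ 3 * h ε i := by
    intro ε i
    have hx : x ε = (fun _ => 1) + ε • (fun j : Fin n => F j) +
        ε ^ 2 • (fun j : Fin n => G j) := by
      funext j; simp [x]
    have hL : ((SimpleGraph.pathGraph n).lapMatrix ℝ).mulVec (x ε) i =
        ε * r i + ε ^ 2 * s i := by
      rw [hx, Matrix.mulVec_add, Matrix.mulVec_add, Matrix.mulVec_smul, Matrix.mulVec_smul,
        SimpleGraph.lapMatrix_mulVec_const_eq_zero]
      simp only [Pi.add_apply, Pi.smul_apply, smul_eq_mul, zero_add]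
      rw [hLF, hLG]
    have hwi : (if i = p then (1 : ℝ) else 0) + (if i = q then 1 else 0) = w i := by
      simp [hw, Fin.ext_iff]
    rw [Matrix.add_mulVec, Matrix.add_mulVec, Matrix.smul_mulVec, Matrix.smul_mulVec]
    simp only [Pi.add_apply, Pi.smul_apply, smul_eq_mul, unitDiag_mulVec_apply]
    rw [hL]
    have : ε * ((if i = p then (1 : ℝ) else 0) * x ε i) +
        ε * ((if i = q then (1 : ℝ) else 0) * x ε i) = ε * w i * x ε i := by
      rw [← hwi]; ring
    rw [add_assoc, this]
    have hw' : w i = 2 / n - r i := by rw [hrw]; ring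
    simp only [x, h, hs, hw']
    ring
  set C : ℝ := ∑ i : Fin n, (|r i * G i| + |β * F i| + |β * G i|) with hC
  have hhC : ∀ ε : ℝ, |ε| ≤ 1 → ∀ i, |h ε i| ≤ C := by
    intro ε hε i
    have h1 : |h ε i| ≤ |r i * G i| + |β * F i| + |β * G i| := by
      have h2 : |ε * (β * G i)| ≤ |β * G i| := by
        rw [abs_mul]; exact mul_le_of_le_one_left (abs_nonneg _) hε
      calc |h ε i| ≤ |-(r i * G i) - β * F i| + |ε * (β * G i)| := abs_sub _ _
        _ ≤ |-(r i * G i)| + |β * F i| + |ε * (β * G i)| := by gcongr; exact abs_sub _ _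
        _ ≤ _ := by rw [abs_neg]; gcongr
    exact h1.trans (Finset.single_le_sum
      (f := fun i : Fin n => |r i * G i| + |β * F i| + |β * G i|)
      (fun i _ => by positivity) (Finset.mem_univ i))
  have hC0 : 0 ≤ C := Finset.sum_nonneg fun i _ => by positivity
  -- The lower bound 1/2 lets the remainder be absorbed as a multiple of `x ε`, at the price of the
  -- factor 2 in 2C.
  have hx : ∀ᶠ ε : ℝ in 𝓝 0, ∀ i, 1 / 2 < x ε i := by
    refine eventually_all.2 fun i => ?_
    have hc : ContinuousAt (fun ε => x ε i) 0 := by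
      simp only [x]; fun_prop
    exact hc.eventually (lt_mem_nhds (by norm_num [x]))
  have h1 : ∀ᶠ ε : ℝ in 𝓝 0, |ε| ≤ 1 := by
    filter_upwards [Metric.ball_mem_nhds (0 : ℝ) one_pos] with ε hε
    rw [Metric.mem_ball, dist_zero_right, Real.norm_eq_abs] at hε
    exact hε.le
  refine IsBigO.of_bound (2 * C) ?_
  filter_upwards [hx, h1] with ε hx h1
  have hpos : ∀ i, 0 < x ε i := fun i => lt_trans (by norm_num) (hx i)
  have hb : ∀ i, |ε ^ 3 * h ε i| ≤ 2 * C * |ε ^ 3| * x ε i := by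
    intro i
    rw [abs_mul]
    calc |ε ^ 3| * |h ε i| ≤ |ε ^ 3| * C := by gcongr; exact hhC ε h1 i
      _ = 2 * C * |ε ^ 3| * (1 / 2) := by ring
      _ ≤ _ := by gcongr; exact (hx i).le
  have hH := twoPort_isHermitian p q ε
  rw [Real.norm_eq_abs, Real.norm_eq_abs, abs_le, twoPortLambdaMin]
  constructor
  · have := le_lambdaMin_of_pos_subsolution hH (x := x ε)
      (ρ := 2 * ε / n + β * ε ^ 2 - 2 * C * |ε ^ 3|) ?_ hpos ?_
    · linarith
    · intro i j hij
      have := lapMatrix_apply_of_ne_nonpos (SimpleGraph.pathGraph n) hij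
      simpa [unitDiag_apply_of_ne _ hij] using this
    · intro i
      rw [hres]
      have := (abs_le.1 (hb i)).1
      linarith
  · have := lambdaMin_le_of_pos_supersolution hH (x := x ε)
      (ρ := 2 * ε / n + β * ε ^ 2 + 2 * C * |ε ^ 3|) hpos ?_
    · linarith
    · intro i
      rw [hres]
      have := (abs_le.1 (hb i)).2
      linarith

end Expansion

/-! ### Maximizing the second-order coefficient -/

section Coefficient

/-- Multiples of 2a + 1 are 2a + 1 apart, so one within distance a of t is its unique nearest
multiple. -/
theorem sq_sub_mul_lt_of_abs_le {t c d a : ℤ} (h : |t - (2 * a + 1) * c| ≤ a) (hcd : d ≠ c) :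
    (t - (2 * a + 1) * c) ^ 2 < (t - (2 * a + 1) * d) ^ 2 := by
  rw [sq_lt_sq]
  refine h.trans_lt ?_
  have ha : 0 ≤ a := (abs_nonneg _).trans h
  obtain ⟨h1, h2⟩ := abs_le.1 h
  rcases lt_or_gt_of_ne hcd with hlt | hgt
  · have : d + 1 ≤ c := hlt
    refine lt_of_lt_of_le ?_ (le_abs_self _)
    nlinarith
  · have : c + 1 ≤ d := hgt
    refine lt_of_lt_of_le ?_ (neg_le_abs _)
    nlinarith

/-- The number of the nodes `p`, `q` among the first `l + 1`. -/
def nodeCount (p q l : ℕ) : ℤ := (if p ≤ l then 1 else 0) + (if q ≤ l then 1 else 0)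

/-- Here 2/n = 1/(2a + 1); clearing denominators makes the deviations integers, so the
nearest-multiple argument applies. -/
theorem twoPortCoeff_eq_sum_sq (a p q : ℕ) :
    twoPortCoeff (4 * a + 2) p q = -(1 / ((4 * (a : ℝ) + 2) * (2 * a + 1) ^ 2)) *
      ((∑ l ∈ Finset.range (4 * a + 2),
        ((l : ℤ) + 1 - (2 * a + 1) * nodeCount p q l) ^ 2 : ℤ) : ℝ) := by
  have h1 : (4 * (a : ℝ) + 2) ≠ 0 := by positivity
  have h2 : (2 * (a : ℝ) + 1) ≠ 0 := by positivity
  have h3 : ∀ l : ℕ, (2 * ((l : ℝ) + 1) / ((4 * a + 2 : ℕ) : ℝ) - (if p ≤ l then 1 else 0) -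
      (if q ≤ l then 1 else 0)) ^ 2 = (1 / (2 * (a : ℝ) + 1) ^ 2) *
      ((l : ℝ) + 1 - (2 * a + 1) * (nodeCount p q l : ℝ)) ^ 2 := by
    intro l
    have h4 : 2 * ((l : ℝ) + 1) / ((4 * a + 2 : ℕ) : ℝ) = (l + 1) / (2 * a + 1) := by
      push_cast
      rw [div_eq_div_iff h1 h2]; ring
    rw [h4, nodeCount]
    push_cast
    field_simp
    ring
  rw [twoPortCoeff, Finset.sum_congr rfl fun l _ => h3 l, ← Finset.mul_sum]
  push_cast
  field_simp

/-- The deviation runs through 1, …, a, then -a, …, a, then -a, …, 0 as the count is 0, 1, 2. -/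
theorem abs_sub_mul_nodeCount_le {a l : ℕ} (hl : l < 4 * a + 2) :
    |(l : ℤ) + 1 - (2 * a + 1) * nodeCount a (3 * a + 1) l| ≤ a := by
  rw [abs_le, nodeCount]
  split_ifs <;> constructor <;> push_cast <;> linarith [show (0:ℤ) ≤ l by positivity]

/-- The count jumps exactly at the nodes, so its values just before and at a and 3a + 1 determine
the unordered pair. -/
theorem exists_nodeCount_ne {a p q : ℕ} (ha : 0 < a)
    (h1 : ¬(p = a ∧ q = 3 * a + 1)) (h2 : ¬(p = 3 * a + 1 ∧ q = a)) :
    ∃ l < 4 * a + 2, nodeCount p q l ≠ nodeCount a (3 * a + 1) l := by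
  by_contra! h
  have e1 := h a (by omega)
  have e2 := h (a - 1) (by omega)
  have e3 := h (3 * a + 1) (by omega)
  have e4 := h (3 * a) (by omega)
  have f1 : (p ≤ a ∧ ¬ q ≤ a) ∨ (¬ p ≤ a ∧ q ≤ a) := by
    rw [nodeCount, nodeCount, if_pos le_rfl, if_neg (by omega : ¬ 3 * a + 1 ≤ a)] at e1
    split_ifs at e1 <;> omega
  have f2 : a ≤ p ∧ a ≤ q := by
    rw [nodeCount, nodeCount, if_neg (by omega : ¬ a ≤ a - 1),
      if_neg (by omega : ¬ 3 * a + 1 ≤ a - 1)] at e2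
    split_ifs at e2 <;> omega
  have f3 : p ≤ 3 * a + 1 ∧ q ≤ 3 * a + 1 := by
    rw [nodeCount, nodeCount, if_pos le_rfl, if_pos (by omega : a ≤ 3 * a + 1)] at e3
    split_ifs at e3 <;> omega
  have f4 : (p ≤ 3 * a ∧ ¬ q ≤ 3 * a) ∨ (¬ p ≤ 3 * a ∧ q ≤ 3 * a) := by
    rw [nodeCount, nodeCount, if_pos (by omega : a ≤ 3 * a),
      if_neg (by omega : ¬ 3 * a + 1 ≤ 3 * a)] at e4
    split_ifs at e4 <;> omega
  clear e1 e2 e3 e4 h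
  omega

theorem twoPortCoeff_lt {a p q : ℕ} (ha : 0 < a)
    (h1 : ¬(p = a ∧ q = 3 * a + 1)) (h2 : ¬(p = 3 * a + 1 ∧ q = a)) :
    twoPortCoeff (4 * a + 2) p q < twoPortCoeff (4 * a + 2) a (3 * a + 1) := by
  rw [twoPortCoeff_eq_sum_sq, twoPortCoeff_eq_sum_sq]
  have hpos : 0 < 1 / ((4 * (a : ℝ) + 2) * (2 * a + 1) ^ 2) := by positivity
  have hlt : ∑ l ∈ Finset.range (4 * a + 2),
        ((l : ℤ) + 1 - (2 * a + 1) * nodeCount a (3 * a + 1) l) ^ 2 <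
      ∑ l ∈ Finset.range (4 * a + 2), ((l : ℤ) + 1 - (2 * a + 1) * nodeCount p q l) ^ 2 := by
    obtain ⟨l, hl, hne⟩ := exists_nodeCount_ne ha h1 h2
    refine Finset.sum_lt_sum (fun l hl => ?_) ⟨l, Finset.mem_range.2 hl,
      sq_sub_mul_lt_of_abs_le (abs_sub_mul_nodeCount_le hl) hne⟩
    rcases eq_or_ne (nodeCount p q l) (nodeCount a (3 * a + 1) l) with he | he
    · rw [he]
    · exact (sq_sub_mul_lt_of_abs_le
        (abs_sub_mul_nodeCount_le (Finset.mem_range.1 hl)) he).le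
  have := mul_lt_mul_of_pos_left (Int.cast_lt (R := ℝ).2 hlt) hpos
  linarith

theorem sum_range_add_sq (x : ℝ) (N : ℕ) :
    ∑ i ∈ Finset.range N, (x + i) ^ 2 =
      N * x ^ 2 + x * N * (N - 1) + N * (N - 1) * (2 * N - 1) / 6 := by
  induction N with
  | zero => simp
  | succ N ih => rw [Finset.sum_range_succ, ih]; push_cast; ring

theorem twoPortCoeff_center (a : ℕ) :
    twoPortCoeff (4 * a + 2) a (3 * a + 1) =
      -((((4 * a + 2 : ℕ) : ℝ) ^ 2 - 4) / (12 * ((4 * a + 2 : ℕ) : ℝ) ^ 2)) := by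
  have hsum : ((∑ l ∈ Finset.range (4 * a + 2),
        ((l : ℤ) + 1 - (2 * a + 1) * nodeCount a (3 * a + 1) l) ^ 2 : ℤ) : ℝ) =
      2 * a * (a + 1) * (2 * a + 1) / 3 := by
    -- Cutting where the count jumps gives in total four copies of 1² + … + a².
    have e : 4 * a + 2 = a + (2 * a + 1) + (a + 1) := by ring
    have s1 : ∀ l ∈ Finset.range a,
        ((l : ℝ) + 1 - (2 * a + 1) * (nodeCount a (3 * a + 1) l : ℝ)) ^ 2 =
          (1 + (l : ℝ)) ^ 2 := by
      intro l hl
      rw [Finset.mem_range] at hl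
      rw [nodeCount, if_neg (by omega), if_neg (by omega)]
      push_cast; ring
    have s2 : ∀ l ∈ Finset.range (2 * a + 1),
        (((a + l : ℕ) : ℝ) + 1 - (2 * a + 1) * (nodeCount a (3 * a + 1) (a + l) : ℝ)) ^ 2 =
          (-(a : ℝ) + l) ^ 2 := by
      intro l hl
      rw [Finset.mem_range] at hl
      rw [nodeCount, if_pos (by omega), if_neg (by omega)]
      push_cast; ring
    have s3 : ∀ l ∈ Finset.range (a + 1),
        (((a + (2 * a + 1) + l : ℕ) : ℝ) + 1 -
          (2 * a + 1) * (nodeCount a (3 * a + 1) (a + (2 * a + 1) + l) : ℝ)) ^ 2 =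
          (-(a : ℝ) + l) ^ 2 := by
      intro l hl
      rw [nodeCount, if_pos (by omega), if_pos (by omega)]
      push_cast; ring
    push_cast
    rw [e, Finset.sum_range_add, Finset.sum_range_add, Finset.sum_congr rfl s1,
      Finset.sum_congr rfl s2, Finset.sum_congr rfl s3, sum_range_add_sq, sum_range_add_sq,
      sum_range_add_sq]
    push_cast
    ring
  rw [twoPortCoeff_eq_sum_sq, hsum]
  push_cast
  have h1 : (4 * (a : ℝ) + 2) ≠ 0 := by positivity
  have h2 : (2 * (a : ℝ) + 1) ≠ 0 := by positivity
  field_simp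
  ring

end Coefficient

/-! ### The cosine eigenbasis and the trigonometric form of the coefficient -/

section Cosines

theorem two_mul_cos_sub (θ α : ℝ) (j : ℝ) :
    2 * Real.cos (θ * j + α) - Real.cos (θ * (j + 1) + α) - Real.cos (θ * (j - 1) + α) =
      (2 - 2 * Real.cos θ) * Real.cos (θ * j + α) := by
  have e1 : θ * (j + 1) + α = (θ * j + α) + θ := by ring
  have e2 : θ * (j - 1) + α = (θ * j + α) - θ := by ring
  rw [e1, e2]
  generalize θ * j + α = x
  rw [Real.cos_add, Real.cos_sub]
  ring

/-- The eigenvectors of the Laplacian of the path graph. -/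
def pathCos (n k : ℕ) (i : ℝ) : ℝ := Real.cos (Real.pi * k * (i + 1 / 2) / n)

variable {n : ℕ} [DecidableRel (SimpleGraph.pathGraph n).Adj]

/-- The cosine is symmetric about -1/2 and, up to a common sign, about n - 1/2, so the ghost values
satisfy the Neumann conditions. -/
theorem lapMatrix_mulVec_pathCos (k : ℕ) :
    ((SimpleGraph.pathGraph n).lapMatrix ℝ).mulVec (fun i => pathCos n k (i : ℕ)) =
      (2 - 2 * Real.cos (Real.pi * k / n)) • fun i : Fin n => pathCos n k (i : ℕ) := by
  funext i
  have hn0 : (n : ℝ) ≠ 0 := by have := i.2; exact_mod_cast (by omega : n ≠ 0)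
  have h := pathGraph_lapMatrix_mulVec_eq (fun j : ℤ => pathCos n k j) i ?_ ?_
  · simp only [Int.cast_natCast, Int.cast_add, Int.cast_sub, Int.cast_one] at h
    rw [h, Pi.smul_apply, smul_eq_mul]
    have := two_mul_cos_sub (Real.pi * k / n) (Real.pi * k / n * (1 / 2)) (i : ℕ)
    simp only [pathCos]
    convert this using 4 <;> ring_nf
  · intro _
    simp only [pathCos]
    rw [← Real.cos_neg]
    push_cast
    ring_nf
  · intro _
    simp only [pathCos]
    push_cast
    have e1 : Real.pi * k * ((n : ℝ) + 1 / 2) / n = Real.pi * k / n * (1 / 2) + k * Real.pi := by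
      field_simp; ring
    have e2 : Real.pi * k * ((n : ℝ) - 1 + 1 / 2) / n =
        -(Real.pi * k / n * (1 / 2)) + k * Real.pi := by
      field_simp; ring
    rw [e1, e2, Real.cos_add_nat_mul_pi, Real.cos_add_nat_mul_pi, Real.cos_neg]

omit [DecidableRel (SimpleGraph.pathGraph n).Adj] in
theorem pathEigenvalue_strictMono {k l : ℕ} (hkl : k < l) (hl : l < n) :
    2 - 2 * Real.cos (Real.pi * k / n) < 2 - 2 * Real.cos (Real.pi * l / n) := by
  have hn : (0 : ℝ) < n := by exact_mod_cast (by omega : 0 < n)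
  have h := Real.cos_lt_cos_of_nonneg_of_le_pi (x := Real.pi * k / n) (y := Real.pi * l / n)
    (by positivity) ?_ ?_
  · linarith
  · rw [div_le_iff₀ hn]
    have : (l : ℝ) ≤ n := by exact_mod_cast hl.le
    exact mul_le_mul_of_nonneg_left this Real.pi_pos.le
  · have : (k : ℝ) < l := by exact_mod_cast hkl
    gcongr

theorem lapMatrix_dotProduct_mulVec_comm {V : Type*} [Fintype V] [DecidableEq V]
    (G : SimpleGraph V) [DecidableRel G.Adj] (x y : V → ℝ) :
    (G.lapMatrix ℝ).mulVec x ⬝ᵥ y = x ⬝ᵥ (G.lapMatrix ℝ).mulVec y := by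
  rw [Matrix.dotProduct_mulVec, ← Matrix.mulVec_transpose, (SimpleGraph.isSymm_lapMatrix ℝ G).eq]

theorem dotProduct_pathCos_eq_zero {μ : ℝ} {v : Fin n → ℝ}
    (hv : ((SimpleGraph.pathGraph n).lapMatrix ℝ).mulVec v = μ • v) {k : ℕ}
    (hk : μ ≠ 2 - 2 * Real.cos (Real.pi * k / n)) :
    v ⬝ᵥ (fun i : Fin n => pathCos n k (i : ℕ)) = 0 := by
  have h := lapMatrix_dotProduct_mulVec_comm (SimpleGraph.pathGraph n) v
    (fun i : Fin n => pathCos n k (i : ℕ))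
  rw [hv, lapMatrix_mulVec_pathCos, smul_dotProduct, dotProduct_smul, smul_eq_mul,
    smul_eq_mul] at h
  have h' : (μ - (2 - 2 * Real.cos (Real.pi * k / n))) *
    (v ⬝ᵥ (fun i : Fin n => pathCos n k (i : ℕ))) = 0 := by linarith
  exact (mul_eq_zero.1 h').resolve_left (sub_ne_zero.2 hk)

omit [DecidableRel (SimpleGraph.pathGraph n).Adj] in
theorem pathCos_zero_pos {k : ℕ} (hk : k < n) : 0 < pathCos n k 0 := by
  have hn : (0 : ℝ) < n := by exact_mod_cast (by omega : 0 < n)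
  refine Real.cos_pos_of_mem_Ioo ⟨?_, ?_⟩
  · have : 0 ≤ Real.pi * k * (0 + 1 / 2) / n := by positivity
    linarith [Real.pi_pos]
  · have : (k : ℝ) < n := by exact_mod_cast hk
    rw [div_lt_iff₀ hn]
    have := mul_lt_mul_of_pos_left this Real.pi_pos
    linarith

omit [DecidableRel (SimpleGraph.pathGraph n).Adj] in
theorem sum_sq_pathCos_pos {k : ℕ} (hk : k < n) :
    0 < ∑ i : Fin n, pathCos n k (i : ℕ) ^ 2 := by
  refine Finset.sum_pos' (fun i _ => sq_nonneg _) ⟨⟨0, by omega⟩, Finset.mem_univ _, ?_⟩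
  have := pathCos_zero_pos hk
  simpa using pow_pos this 2

/-- The expansion of a vector in the cosine basis. -/
theorem eq_sum_pathCos (v : Fin n → ℝ) (i : Fin n) :
    v i = ∑ k : Fin n, (v ⬝ᵥ fun j : Fin n => pathCos n k (j : ℕ)) * pathCos n k (i : ℕ) /
      ∑ j : Fin n, pathCos n k (j : ℕ) ^ 2 := by
  classical
  let U : Matrix (Fin n) (Fin n) ℝ := Matrix.of fun k j => pathCos n k (j : ℕ)
  let W : Matrix (Fin n) (Fin n) ℝ :=
    Matrix.of fun j k => pathCos n k (j : ℕ) / ∑ j : Fin n, pathCos n k (j : ℕ) ^ 2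
  have hUW : U * W = 1 := by
    ext k l
    rw [Matrix.mul_apply]
    simp only [U, W, Matrix.of_apply]
    by_cases hkl : k = l
    · subst hkl
      rw [Matrix.one_apply_eq, ← div_self (sum_sq_pathCos_pos k.2).ne', Finset.sum_div]
      exact Finset.sum_congr rfl fun j _ => by ring
    · rw [Matrix.one_apply_ne hkl]
      have h0 := dotProduct_pathCos_eq_zero (lapMatrix_mulVec_pathCos (n := n) k) (k := l) (by
        rcases lt_or_gt_of_ne (fun h => hkl (Fin.ext h) : (k : ℕ) ≠ l) with h | h
        · exact (pathEigenvalue_strictMono h l.2).ne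
        · exact (pathEigenvalue_strictMono h k.2).ne')
      have : ∑ j : Fin n, pathCos n k (j : ℕ) *
          (pathCos n l (j : ℕ) / ∑ j : Fin n, pathCos n l (j : ℕ) ^ 2) =
          (∑ j : Fin n, pathCos n k (j : ℕ) * pathCos n l (j : ℕ)) /
            ∑ j : Fin n, pathCos n l (j : ℕ) ^ 2 := by
        rw [Finset.sum_div]
        exact Finset.sum_congr rfl fun j _ => by ring
      rw [this]
      rw [dotProduct] at h0
      rw [h0, zero_div]
  -- Orthogonality of n modes gives a one-sided inverse; for square matrices it is two-sided, which
  -- is completeness.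
  have hWU : W * U = 1 := mul_eq_one_comm.1 hUW
  have h : (W * U).mulVec v i = v i := by rw [hWU, Matrix.one_mulVec]
  rw [← Matrix.mulVec_mulVec] at h
  rw [← h]
  simp only [Matrix.mulVec, dotProduct, U, W, Matrix.of_apply]
  refine Finset.sum_congr rfl fun k _ => ?_
  rw [mul_comm (pathCos n k (i : ℕ) / _), mul_div_assoc]
  congr 1
  exact Finset.sum_congr rfl fun j _ => mul_comm _ _

theorem dotProduct_eq_sum_pathCos (v w : Fin n → ℝ) :
    v ⬝ᵥ w = ∑ k : Fin n, (v ⬝ᵥ fun j : Fin n => pathCos n k (j : ℕ)) *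
      (w ⬝ᵥ fun j : Fin n => pathCos n k (j : ℕ)) / ∑ j : Fin n, pathCos n k (j : ℕ) ^ 2 := by
  conv_lhs => rw [dotProduct, Finset.sum_congr rfl fun i _ => by rw [eq_sum_pathCos v i]]
  simp only [Finset.sum_mul]
  rw [Finset.sum_comm]
  refine Finset.sum_congr rfl fun k _ => ?_
  rw [show (w ⬝ᵥ fun j : Fin n => pathCos n k (j : ℕ)) = ∑ i, w i * pathCos n k (i : ℕ) from rfl,
    Finset.mul_sum, Finset.sum_div]
  exact Finset.sum_congr rfl fun i _ => by ring

omit [DecidableRel (SimpleGraph.pathGraph n).Adj] in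
theorem pathEigenvalue_eq_sin (k : ℕ) :
    2 - 2 * Real.cos (Real.pi * k / n) = 4 * Real.sin (Real.pi * k / (2 * n)) ^ 2 := by
  have : Real.pi * k / n = 2 * (Real.pi * k / (2 * n)) := by
    rw [mul_comm (2 : ℝ) n, ← div_div]; ring
  rw [this, Real.cos_two_mul, ← Real.sin_sq_add_cos_sq (Real.pi * k / (2 * n))]
  nlinarith [Real.sin_sq_add_cos_sq (Real.pi * k / (2 * n))]

/-- Parseval for the energy of r against its potential F: each mode of F is that of r divided by the
eigenvalue, and orthogonality to constants leaves only the values at p and q in the modes of r. -/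
theorem twoPortCoeff_eq_sum_pathCos (p q : Fin n) :
    twoPortCoeff n p q = -(1 / (4 * (n : ℝ)) * ∑ k ∈ Finset.range (n - 1),
      (pathCos n (k + 1) (p : ℕ) + pathCos n (k + 1) (q : ℕ)) ^ 2 /
        (Real.sin (Real.pi * (k + 1 : ℕ) / (2 * n)) ^ 2 *
          ∑ j ∈ Finset.range n, pathCos n (k + 1) j ^ 2)) := by
  have hn : 0 < n := by have := p.2; omega
  have hn0 : (n : ℝ) ≠ 0 := by exact_mod_cast hn.ne'
  set r := twoPortCharge n p q with hr
  set F := pathPotential r with hF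
  set u : ℕ → Fin n → ℝ := fun k j => pathCos n k (j : ℕ) with hu
  have hLF : ((SimpleGraph.pathGraph n).lapMatrix ℝ).mulVec (fun j => F (j : ℕ)) =
      fun j : Fin n => r j :=
    funext fun i => lapMatrix_mulVec_pathPotential (n := n) r (sum_range_twoPortCharge p q) i
  have hrF : (fun j : Fin n => r j) ⬝ᵥ (fun j : Fin n => F j) = -(n * twoPortCoeff n p q) := by
    rw [← sum_twoPortCharge_mul_potential, dotProduct,
      Fin.sum_univ_eq_sum_range (fun j => r j * F j)]
  have hmode : ∀ k, (fun j : Fin n => r j) ⬝ᵥ u k =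
      (2 - 2 * Real.cos (Real.pi * k / n)) * ((fun j : Fin n => F j) ⬝ᵥ u k) := by
    intro k
    rw [← hLF, lapMatrix_dotProduct_mulVec_comm, lapMatrix_mulVec_pathCos, dotProduct_smul,
      smul_eq_mul]
  have hone : ∀ k, k + 1 < n → ∑ j : Fin n, pathCos n (k + 1) (j : ℕ) = 0 := by
    intro k hk
    have h0 := pathEigenvalue_strictMono (k := 0) (Nat.succ_pos k) hk
    have := dotProduct_pathCos_eq_zero (n := n) (μ := 0) (v := fun _ => 1) (k := k + 1)
      (by rw [SimpleGraph.lapMatrix_mulVec_const_eq_zero, zero_smul])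
      (by simp at h0 ⊢; linarith)
    simpa [dotProduct] using this
  have hcharge : ∀ k, k + 1 < n → (fun j : Fin n => r j) ⬝ᵥ u (k + 1) =
      -(pathCos n (k + 1) (p : ℕ) + pathCos n (k + 1) (q : ℕ)) := by
    intro k hk
    simp only [dotProduct, hr, hu, twoPortCharge, sub_mul, add_mul, Finset.sum_sub_distrib,
      Finset.sum_add_distrib, ← Finset.mul_sum, hone k hk, ite_mul, one_mul, zero_mul,
      ← Fin.ext_iff, Finset.sum_ite_eq', Finset.mem_univ, if_true]
    ring
  have hP := dotProduct_eq_sum_pathCos (fun j : Fin n => r j) (fun j : Fin n => F j)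
  rw [hrF] at hP
  have hP' : -(n * twoPortCoeff n p q) = ∑ k ∈ Finset.range n,
      ((fun j : Fin n => r j) ⬝ᵥ u k) * ((fun j : Fin n => F j) ⬝ᵥ u k) /
        ∑ j : Fin n, pathCos n k (j : ℕ) ^ 2 := by
    rw [hP, ← Fin.sum_univ_eq_sum_range (fun k => ((fun j : Fin n => r j) ⬝ᵥ u k) *
      ((fun j : Fin n => F j) ⬝ᵥ u k) / ∑ j : Fin n, pathCos n k (j : ℕ) ^ 2)]
  obtain ⟨N, hN⟩ : ∃ N, n = N + 1 := ⟨n - 1, by omega⟩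
  -- The constant mode, whose eigenvalue is zero, drops out by neutrality.
  have hr0 : (fun j : Fin n => r j) ⬝ᵥ u 0 = 0 := by rw [hmode]; simp
  have hsplit : -(n * twoPortCoeff n p q) = ∑ k ∈ Finset.range (n - 1),
      (pathCos n (k + 1) (p : ℕ) + pathCos n (k + 1) (q : ℕ)) ^ 2 /
        (4 * (Real.sin (Real.pi * (k + 1 : ℕ) / (2 * n)) ^ 2 *
          ∑ j ∈ Finset.range n, pathCos n (k + 1) j ^ 2)) := by
    have hsr : ∀ f : ℕ → ℝ, ∑ k ∈ Finset.range n, f k =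
        ∑ k ∈ Finset.range (n - 1), f (k + 1) + f 0 := by
      intro f
      have h : n - 1 + 1 = n := by omega
      rw [← Finset.sum_range_succ', h]
    rw [hP', hsr, hr0, zero_mul, zero_div, add_zero]
    refine Finset.sum_congr rfl fun k hk => ?_
    rw [Finset.mem_range] at hk
    have hk' : k + 1 < n := by omega
    have hpos := pathEigenvalue_strictMono (k := 0) (Nat.succ_pos k) hk'
    have hlam : (2 - 2 * Real.cos (Real.pi * (k + 1 : ℕ) / n)) ≠ 0 := by
      simp at hpos; push_cast; linarith
    have hF' := hmode (k + 1)
    rw [hcharge k hk'] at hF'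
    have hFk : (fun j : Fin n => F j) ⬝ᵥ u (k + 1) =
        -(pathCos n (k + 1) (p : ℕ) + pathCos n (k + 1) (q : ℕ)) /
          (2 - 2 * Real.cos (Real.pi * (k + 1 : ℕ) / n)) := by
      rw [hF', mul_div_cancel_left₀ _ hlam]
    rw [hcharge k hk', hFk, Fin.sum_univ_eq_sum_range (fun j => pathCos n (k + 1) (j : ℕ) ^ 2),
      pathEigenvalue_eq_sin, ← mul_assoc, ← mul_div_assoc, div_div]
    congr 1
    ring
  have hfin : twoPortCoeff n p q = -(1 / (n : ℝ)) * -(n * twoPortCoeff n p q) := by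
    field_simp
  rw [hfin, hsplit, Finset.mul_sum, Finset.mul_sum, ← Finset.sum_neg_distrib]
  refine Finset.sum_congr rfl fun k _ => ?_
  rw [← div_div]
  ring

end Cosines

/-! ### Grounded Laplacians and principal submatrices of Z -/

section Grounded

variable {V : Type*} [Fintype V] [DecidableEq V] (G : SimpleGraph V) [DecidableRel G.Adj]

theorem stochasticMatrix_isHermitian (τ : ℝ) : (stochasticMatrix G τ).IsHermitian :=
  Matrix.isHermitian_one.sub ((SimpleGraph.isHermitian_lapMatrix ℝ G).smul (IsSelfAdjoint.all τ))

theorem subStochastic_isHermitian (τ : ℝ) (S : Finset V) : (subStochastic G τ S).IsHermitian :=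
  (stochasticMatrix_isHermitian G τ).submatrix _

/-- The deleted columns meet only zero entries of v, so the submatrix can be studied through the
full Laplacian. -/
theorem subStochastic_mulVec (τ : ℝ) {S : Finset V} {v : V → ℝ} (hv : ∀ i ∈ S, v i = 0)
    (i : {i : V // i ∉ S}) :
    (subStochastic G τ S).mulVec (fun j => v j) i = v i - τ * (G.lapMatrix ℝ).mulVec v i := by
  have h1 : (stochasticMatrix G τ).mulVec v i = v i - τ * (G.lapMatrix ℝ).mulVec v i := by
    rw [stochasticMatrix, Matrix.sub_mulVec, Matrix.smul_mulVec, Matrix.one_mulVec]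
    rfl
  rw [← h1]
  have h2 := Fintype.sum_subtype_add_sum_subtype (fun j => j ∉ S)
    (fun j => stochasticMatrix G τ i j * v j)
  have h3 : ∑ j : {j // ¬ j ∉ S}, stochasticMatrix G τ i j * v j = 0 :=
    Finset.sum_eq_zero fun j _ => by rw [hv j (not_not.1 j.2), mul_zero]
  rw [h3, add_zero] at h2
  exact h2

theorem mem_spectrum_subStochastic (τ : ℝ) {S : Finset V} {v : V → ℝ} (hv : ∀ i ∈ S, v i = 0)
    (h0 : v ≠ 0) {μ : ℝ} (h : ∀ i, i ∉ S → (G.lapMatrix ℝ).mulVec v i = μ * v i) :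
    1 - τ * μ ∈ spectrum ℝ (subStochastic G τ S) := by
  refine mem_spectrum_iff_exists_mulVec.2 ⟨fun j => v j, ?_, ?_⟩
  · intro hz
    refine h0 (funext fun i => ?_)
    by_cases hi : i ∈ S
    · exact hv i hi
    · exact congrFun hz ⟨i, hi⟩
  · funext i
    rw [subStochastic_mulVec G τ hv, h i i.2, Pi.smul_apply, smul_eq_mul]
    ring

theorem lambdaMax_subStochastic_le {τ : ℝ} (hτ : 0 ≤ τ) {S : Finset V}
    [Nonempty {i : V // i ∉ S}] {v : V → ℝ} (hv : ∀ i ∈ S, v i = 0)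
    (hpos : ∀ i, i ∉ S → 0 < v i) {μ : ℝ}
    (h : ∀ i, i ∉ S → (G.lapMatrix ℝ).mulVec v i = μ * v i) :
    lambdaMax (subStochastic G τ S) ≤ 1 - τ * μ := by
  refine eigenvalue_le_of_pos_supersolution (x := fun j : {i : V // i ∉ S} => v j) ?_ (fun i => hpos i i.2) ?_
    (lambdaMax_isGreatest (subStochastic_isHermitian G τ S)).1
  · intro i j hij
    have hij' : (i : V) ≠ j := fun h => hij (Subtype.ext h)
    have := mul_nonpos_of_nonneg_of_nonpos hτ (lapMatrix_apply_of_ne_nonpos G hij')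
    rw [subStochastic, Matrix.submatrix_apply, stochasticMatrix, Matrix.sub_apply,
      Matrix.one_apply_ne hij', Matrix.smul_apply, smul_eq_mul]
    linarith
  · intro i
    rw [subStochastic_mulVec G τ hv, h i i.2]
    linarith

end Grounded

/-! ### Ground states of the segments left by grounding two nodes -/

section Segments

variable {n : ℕ} [DecidableRel (SimpleGraph.pathGraph n).Adj]

/-- A solution `c` of the eigenvalue equation on the line gives an eigenvector on the segment
strictly between `A` and `B`, each of which is a zero of `c` or lies beyond an end of the path. -/
theorem lapMatrix_mulVec_segment {c : ℤ → ℝ} {μ : ℝ}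
    (hc : ∀ j, 2 * c j - c (j + 1) - c (j - 1) = μ * c j) {A B : ℤ}
    (hA : (0 ≤ A ∧ c A = 0) ∨ (A = -2 ∧ c (-1) = c 0))
    (hB : (B < n ∧ c B = 0) ∨ (B = n + 1 ∧ c n = c ((n : ℤ) - 1)))
    (hB1 : 1 ≤ B) (hA1 : A + 1 < n) (i : Fin n) (hiA : ((i : ℕ) : ℤ) ≠ A)
    (hiB : ((i : ℕ) : ℤ) ≠ B) :
    ((SimpleGraph.pathGraph n).lapMatrix ℝ).mulVec
      (fun j => if A < (j : ℕ) ∧ ((j : ℕ) : ℤ) < B then c (j : ℕ) else 0) i =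
      μ * (if A < (i : ℕ) ∧ ((i : ℕ) : ℤ) < B then c (i : ℕ) else 0) := by
  have hi := i.2
  rw [pathGraph_lapMatrix_mulVec_eq (fun j : ℤ => if A < j ∧ j < B then c j else 0) i]
  · by_cases hin : A < (i : ℕ) ∧ ((i : ℕ) : ℤ) < B
    · have e1 : (if A < ((i : ℕ) : ℤ) + 1 ∧ ((i : ℕ) : ℤ) + 1 < B then c ((i : ℕ) + 1) else 0) =
          c ((i : ℕ) + 1) := by
        split_ifs with h
        · rfl
        · have hB' : ((i : ℕ) : ℤ) + 1 = B := by omega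
          rcases hB with hB | hB
          · rw [hB', hB.2]
          · omega
      have e2 : (if A < ((i : ℕ) : ℤ) - 1 ∧ ((i : ℕ) : ℤ) - 1 < B then c ((i : ℕ) - 1) else 0) =
          c ((i : ℕ) - 1) := by
        split_ifs with h
        · rfl
        · have hA' : ((i : ℕ) : ℤ) - 1 = A := by omega
          rcases hA with hA | hA
          · rw [hA', hA.2]
          · omega
      simp only [e1, e2, if_pos hin, hc]
    -- A node outside the segment and different from A and B has no neighbour inside it.
    · simp only [if_neg hin]
      rw [if_neg (by omega), if_neg (by omega)]
      ring
  · intro h0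
    rcases hA with hA | hA
    · rw [if_neg (by omega), if_neg (by omega)]
    -- The sentinel -2, rather than -1, keeps the ghost node -1 strictly inside the segment; n + 1
    -- does the same for n at the other end.
    · rw [if_pos (by omega), if_pos (by omega), hA.2]
  · intro h0
    rcases hB with hB | hB
    · rw [if_neg (by omega), if_neg (by omega)]
    · rw [if_pos (by omega), if_pos (by omega), hB.2]

theorem two_sub_two_mul_cos_lt {x y : ℝ} (hx : 1 ≤ x) (hxy : x < y) :
    2 - 2 * Real.cos (Real.pi / y) < 2 - 2 * Real.cos (Real.pi / x) := by
  have hpi := Real.pi_pos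
  have hx0 : 0 < x := by linarith
  have hy0 : 0 < y := by linarith
  have := Real.cos_lt_cos_of_nonneg_of_le_pi (x := Real.pi / y) (y := Real.pi / x)
    (by positivity) (div_le_self hpi.le hx) (by gcongr)
  linarith

/-- Grounding a pair of nodes other than the 2-center leaves a segment with a smaller
eigenvalue. -/
theorem exists_grounded_eigenvector {a : ℕ} (ha : 0 < a) (hn : n = 4 * a + 2) {p q : Fin n}
    (hpq : p < q) (hne : ¬((p : ℕ) = a ∧ (q : ℕ) = 3 * a + 1)) :
    ∃ μ < 2 - 2 * Real.cos (Real.pi / (2 * a + 1)), ∃ v : Fin n → ℝ, v p = 0 ∧ v q = 0 ∧ v ≠ 0 ∧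
      ∀ i, i ≠ p → i ≠ q → ((SimpleGraph.pathGraph n).lapMatrix ℝ).mulVec v i = μ * v i := by
  have ha0 : (0 : ℝ) < a := by exact_mod_cast ha
  have hpq' : (p : ℕ) < q := hpq
  have hp := p.2
  have hq := q.2
  have hcos : ∀ θ α : ℝ, ∀ j : ℤ, 2 * Real.cos (θ * j + α) - Real.cos (θ * (j + 1 : ℤ) + α) -
      Real.cos (θ * (j - 1 : ℤ) + α) = (2 - 2 * Real.cos θ) * Real.cos (θ * j + α) := by
    intro θ α j
    push_cast
    exact two_mul_cos_sub θ α j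
  have hend : ∀ y : ℝ, 1 < y → 0 < Real.cos (Real.pi / y * (1 / 2)) := by
    intro y hy
    have := Real.pi_pos
    have h1 : 0 < Real.pi / y := by positivity
    have h2 : Real.pi / y < Real.pi := div_lt_self this hy
    exact Real.cos_pos_of_mem_Ioo ⟨by linarith, by linarith⟩
  -- If all three fail, then p ≤ a, q - p ≤ 2a + 1 and q ≥ 3a + 1, which forces the center.
  have hcases : a < (p : ℕ) ∨ (p : ℕ) + (2 * a + 1) < q ∨ (q : ℕ) < 3 * a + 1 := by omega
  rcases hcases with h | h | h
  · have hy : (2 * (a : ℝ) + 1) < 2 * (p : ℕ) + 1 := by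
      have : (a : ℝ) < (p : ℕ) := by exact_mod_cast h
      linarith
    -- Left segment: the cosine even about -1/2 with first zero at p.
    set θ := Real.pi / (2 * ((p : ℕ) : ℝ) + 1) with hθ
    refine ⟨2 - 2 * Real.cos θ, two_sub_two_mul_cos_lt (by linarith) hy, _, ?_, ?_, ?_,
      fun i hip hiq => lapMatrix_mulVec_segment (A := -2) (B := (p : ℕ))
        (hcos θ (θ * (1 / 2))) (Or.inr ⟨rfl, ?_⟩) (Or.inl ⟨by omega, ?_⟩) (by omega) (by omega) i
        (by omega) (fun h => hip (Fin.ext (by omega)))⟩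
    · exact if_neg (by omega)
    · exact if_neg (by omega)
    · intro hz
      have := congrFun hz ⟨0, by omega⟩
      simp only [Pi.zero_apply] at this
      rw [if_pos (by omega)] at this
      refine (hend (2 * ((p : ℕ) : ℝ) + 1) ?_).ne' ?_
      · have : (0 : ℝ) < (p : ℕ) := by exact_mod_cast (by omega : 0 < (p : ℕ))
        linarith
      · rw [← hθ, ← this]; push_cast; ring_nf
    · rw [← Real.cos_neg]; push_cast; ring_nf
    · rw [← Real.cos_pi_div_two, hθ]
      congr 1
      have : (2 * ((p : ℕ) : ℝ) + 1) ≠ 0 := by positivity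
      push_cast
      field_simp
  · have hy : (2 * (a : ℝ) + 1) < (q : ℕ) - (p : ℕ) := by
      have : (((p : ℕ) + (2 * a + 1) : ℕ) : ℝ) < (q : ℕ) := by exact_mod_cast h
      push_cast at this
      linarith
    -- Middle segment: the phase turns the cosine into sin(θ(j - p)), which vanishes at p and q.
    set θ := Real.pi / (((q : ℕ) : ℝ) - (p : ℕ)) with hθ
    refine ⟨2 - 2 * Real.cos θ, two_sub_two_mul_cos_lt (by linarith) hy, _, ?_, ?_, ?_,
      fun i hip hiq => lapMatrix_mulVec_segment (A := (p : ℕ)) (B := (q : ℕ))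
        (hcos θ (-(θ * (p : ℕ)) - Real.pi / 2)) (Or.inl ⟨by omega, ?_⟩) (Or.inl ⟨by omega, ?_⟩)
        (by omega) (by omega) i
        (fun h => hip (Fin.ext (by omega))) (fun h => hiq (Fin.ext (by omega)))⟩
    · exact if_neg (by omega)
    · exact if_neg (by omega)
    · intro hz
      have := congrFun hz ⟨p + 1, by omega⟩
      simp only [Pi.zero_apply] at this
      rw [if_pos (by omega)] at this
      have e : θ * (((p : ℕ) + 1 : ℕ) : ℤ) + (-(θ * (p : ℕ)) - Real.pi / 2) =
          θ - Real.pi / 2 := by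
        push_cast; ring
      rw [e, Real.cos_sub_pi_div_two] at this
      have hpi := Real.pi_pos
      exact (Real.sin_pos_of_pos_of_lt_pi (div_pos hpi (by linarith))
        (div_lt_self hpi (by linarith))).ne' this
    · rw [← Real.cos_pi_div_two, ← Real.cos_neg]; push_cast; ring_nf
    · rw [← Real.cos_pi_div_two, hθ]
      congr 1
      have : (((q : ℕ) : ℝ) - (p : ℕ)) ≠ 0 := by linarith
      push_cast
      field_simp
      ring
  · obtain ⟨b, hb⟩ : ∃ b : ℕ, (q : ℕ) + b + 1 = n := ⟨n - 1 - q, by omega⟩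
    have hnb : (n : ℝ) = (q : ℕ) + b + 1 := by exact_mod_cast hb.symm
    have hab : a < b := by omega
    have hy : (2 * (a : ℝ) + 1) < 2 * b + 1 := by
      have : (a : ℝ) < b := by exact_mod_cast hab
      linarith
    -- Right segment, with b nodes beyond q: the cosine even about n - 1/2 that vanishes at q.
    set θ := Real.pi / (2 * (b : ℝ) + 1) with hθ
    refine ⟨2 - 2 * Real.cos θ, two_sub_two_mul_cos_lt (by linarith) hy, _, ?_, ?_, ?_,
      fun i hip hiq => lapMatrix_mulVec_segment (A := (q : ℕ)) (B := n + 1)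
        (hcos θ (-(θ * (n - 1 / 2)))) (Or.inl ⟨by omega, ?_⟩) (Or.inr ⟨rfl, ?_⟩) (by omega)
        (by omega) i (fun h => hiq (Fin.ext (by omega))) (by have := i.2; omega)⟩
    · exact if_neg (by omega)
    · exact if_neg (by omega)
    · intro hz
      have := congrFun hz ⟨q + b, by omega⟩
      simp only [Pi.zero_apply] at this
      rw [if_pos (by omega)] at this
      refine (hend (2 * (b : ℝ) + 1) ?_).ne' ?_
      · have : (0 : ℝ) < b := by exact_mod_cast (by omega : 0 < b)
        linarith
      · rw [← hθ, ← this, ← Real.cos_neg, hnb]; push_cast; ring_nf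
    · rw [← Real.cos_pi_div_two, ← Real.cos_neg, hθ, hnb]
      congr 1
      have : (2 * (b : ℝ) + 1) ≠ 0 := by positivity
      push_cast
      field_simp
      ring
    · rw [← Real.cos_neg]; push_cast; ring_nf

/-- The modulus of the third cosine mode is the ground state of the path grounded at the
2-center. -/
theorem exists_center_grounded_eigenvector {a : ℕ} (ha : 0 < a) (hn : n = 4 * a + 2) :
    ∃ v : Fin n → ℝ, (∀ i : Fin n, (i : ℕ) = a ∨ (i : ℕ) = 3 * a + 1 → v i = 0) ∧
      (∀ i : Fin n, (i : ℕ) ≠ a → (i : ℕ) ≠ 3 * a + 1 → 0 < v i ∧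
        ((SimpleGraph.pathGraph n).lapMatrix ℝ).mulVec v i =
          (2 - 2 * Real.cos (Real.pi / (2 * a + 1))) * v i) := by
  set θ := Real.pi / (2 * (a : ℝ) + 1) with hθ
  have hy : (0 : ℝ) < 2 * a + 1 := by positivity
  have hpi := Real.pi_pos
  have hθ0 : 0 < θ := div_pos hpi hy
  have hθa : θ * (2 * a + 1) = Real.pi := div_mul_cancel₀ _ hy.ne'
  have hθ1 : θ * 1 ≤ θ * a :=
    mul_le_mul_of_nonneg_left (by exact_mod_cast ha) hθ0.le
  set c : ℤ → ℝ := fun j => Real.cos (θ * (j : ℝ) + θ * (1 / 2)) with hc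
  have hcj : ∀ j : ℤ, 2 * c j - c (j + 1) - c (j - 1) = (2 - 2 * Real.cos θ) * c j := by
    intro j
    have := two_mul_cos_sub θ (θ * (1 / 2)) j
    simp only [hc]; push_cast; exact this
  have hz1 : c a = 0 := by
    simp only [hc]; rw [← Real.cos_pi_div_two]; congr 1; push_cast; linarith
  have hz2 : c (3 * a + 1) = 0 := by
    have : c (3 * a + 1) = Real.cos (Real.pi / 2 + Real.pi) := by
      simp only [hc]; congr 1; push_cast; linarith
    rw [this, Real.cos_add_pi, Real.cos_pi_div_two, neg_zero]
  -- The sign ranges include the ghost nodes -1 here and n = 4a + 2 in `hp3`, since they enter the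
  -- second difference at the ends.
  have hp1 : ∀ j : ℤ, -1 ≤ j → j < a → 0 < c j := by
    intro j h1 h2
    have h1' : (-1 : ℝ) ≤ j := by exact_mod_cast h1
    have h2' : (j : ℝ) + 1 ≤ a := by exact_mod_cast h2
    have g1 := mul_le_mul_of_nonneg_left h1' hθ0.le
    have g2 := mul_le_mul_of_nonneg_left h2' hθ0.le
    exact Real.cos_pos_of_mem_Ioo ⟨by linarith, by linarith⟩
  have hp2 : ∀ j : ℤ, (a : ℤ) < j → j < 3 * a + 1 → c j < 0 := by
    intro j h1 h2
    have h1' : (a : ℝ) + 1 ≤ j := by exact_mod_cast h1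
    have h2' : (j : ℝ) + 1 ≤ 3 * a + 1 := by exact_mod_cast h2
    have g1 := mul_le_mul_of_nonneg_left h1' hθ0.le
    have g2 := mul_le_mul_of_nonneg_left h2' hθ0.le
    exact Real.cos_neg_of_pi_div_two_lt_of_lt (by linarith) (by linarith)
  have hp3 : ∀ j : ℤ, 3 * (a : ℤ) + 1 < j → j ≤ 4 * a + 2 → 0 < c j := by
    intro j h1 h2
    have h1' : 3 * (a : ℝ) + 1 + 1 ≤ j := by exact_mod_cast h1
    have h2' : (j : ℝ) ≤ 4 * a + 2 := by exact_mod_cast h2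
    have g1 := mul_le_mul_of_nonneg_left h1' hθ0.le
    have g2 := mul_le_mul_of_nonneg_left h2' hθ0.le
    simp only [hc]
    rw [← Real.cos_sub_two_pi]
    exact Real.cos_pos_of_mem_Ioo ⟨by linarith, by linarith⟩
  have hn' : (n : ℤ) = 4 * a + 2 := by exact_mod_cast hn
  -- Each neighbour of an ungrounded node has the same sign or is a zero, so the modulus still
  -- solves the equation there.
  refine ⟨fun i => |c (i : ℕ)|, ?_, ?_⟩
  · rintro i (h | h)
    · simp only [h, hz1, abs_zero]
    · simp only [h]; push_cast; rw [hz2, abs_zero]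
  · intro i h1 h2
    have hi := i.2
    have hlap := pathGraph_lapMatrix_mulVec_eq (fun j => |c j|) i ?_ ?_
    · rw [hlap]
      simp only
      rcases lt_trichotomy (i : ℕ) a with h | h | h
      · have e0 := hp1 (i : ℕ) (by omega) (by omega)
        have e1 : 0 ≤ c ((i : ℕ) + 1) := by
          rcases eq_or_ne ((i : ℕ) + 1) a with h' | h'
          · have : (((i : ℕ) : ℤ) + 1) = a := by exact_mod_cast h'
            rw [this, hz1]
          · exact (hp1 _ (by omega) (by omega)).le
        have e2 := hp1 ((i : ℕ) - 1) (by omega) (by omega)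
        rw [abs_of_pos e0, abs_of_nonneg e1, abs_of_pos e2]
        exact ⟨e0, hcj _⟩
      · exact absurd h h1
      · rcases lt_trichotomy (i : ℕ) (3 * a + 1) with h' | h' | h'
        · have e0 := hp2 (i : ℕ) (by omega) (by omega)
          have e1 : c ((i : ℕ) + 1) ≤ 0 := by
            rcases eq_or_ne ((i : ℕ) + 1) (3 * a + 1) with h'' | h''
            · have : (((i : ℕ) : ℤ) + 1) = 3 * a + 1 := by exact_mod_cast h''
              rw [this, hz2]
            · exact (hp2 _ (by omega) (by omega)).le
          have e2 : c ((i : ℕ) - 1) ≤ 0 := by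
            rcases eq_or_ne (i : ℕ) (a + 1) with h'' | h''
            · have : (((i : ℕ) : ℤ) - 1) = a := by omega
              rw [this, hz1]
            · exact (hp2 _ (by omega) (by omega)).le
          rw [abs_of_neg e0, abs_of_nonpos e1, abs_of_nonpos e2]
          exact ⟨by linarith, by linarith [hcj (i : ℕ)]⟩
        · exact absurd h' h2
        · have e0 := hp3 (i : ℕ) (by omega) (by omega)
          have e1 := hp3 ((i : ℕ) + 1) (by omega) (by omega)
          have e2 : 0 ≤ c ((i : ℕ) - 1) := by
            rcases eq_or_ne (i : ℕ) (3 * a + 2) with h'' | h''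
            · have : (((i : ℕ) : ℤ) - 1) = 3 * a + 1 := by omega
              rw [this, hz2]
            · exact (hp3 _ (by omega) (by omega)).le
          rw [abs_of_pos e0, abs_of_pos e1, abs_of_nonneg e2]
          exact ⟨e0, hcj _⟩
    · intro _
      have : c (-1) = c 0 := by
        simp only [hc]; rw [← Real.cos_neg]; push_cast; ring_nf
      simp only [this]
    · intro _
      have : c n = c ((n : ℤ) - 1) := by
        simp only [hc, hn']
        rw [← Real.cos_neg, ← Real.cos_add_two_pi, ← Real.cos_add_two_pi]
        congr 1
        push_cast
        linarith
      simp only [this]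

end Segments

/-! ### Comparing pairs in the three senses, and the third eigenvector -/

section PathCenter

theorem eventually_lt_of_expansion {f g : ℝ → ℝ} {α β γ : ℝ}
    (hf : (fun ε : ℝ => f ε - (α * ε + β * ε ^ 2)) =O[𝓝 0] (fun ε : ℝ => ε ^ 3))
    (hg : (fun ε : ℝ => g ε - (α * ε + γ * ε ^ 2)) =O[𝓝 0] (fun ε : ℝ => ε ^ 3))
    (h : β < γ) : ∀ᶠ ε : ℝ in 𝓝[≠] 0, f ε < g ε := by
  obtain ⟨c, hc⟩ := hf.bound
  obtain ⟨d, hd⟩ := hg.bound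
  have hsmall : ∀ᶠ ε : ℝ in 𝓝 0, (c + d) * |ε| < γ - β := by
    have hcont : ContinuousAt (fun ε : ℝ => (c + d) * |ε|) 0 := by fun_prop
    exact hcont.eventually (gt_mem_nhds (by simpa using h))
  filter_upwards [nhdsWithin_le_nhds hc, nhdsWithin_le_nhds hd, nhdsWithin_le_nhds hsmall,
    self_mem_nhdsWithin] with ε h1 h2 h3 h4
  rw [Real.norm_eq_abs, Real.norm_eq_abs, abs_pow] at h1 h2
  have h1' := (abs_le.1 h1).2
  have h2' := (abs_le.1 h2).1
  have hε : 0 < |ε| := abs_pos.2 h4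
  have h5 := mul_lt_mul_of_pos_right h3 (pow_pos hε 2)
  rw [sq_abs] at h5
  have h6 : (c + d) * |ε| * ε ^ 2 = (c + d) * |ε| ^ 3 := by rw [← sq_abs ε]; ring
  rw [h6] at h5
  linarith

theorem mk_ne_mk_of_pair_ne {α : Type*} [DecidableEq α] {p q p₁ p₂ : α}
    (h : ({p, q} : Finset α) ≠ {p₁, p₂}) : s(p, q) ≠ s(p₁, p₂) := by
  intro he
  rcases Sym2.eq_iff.1 he with ⟨rfl, rfl⟩ | ⟨rfl, rfl⟩
  · exact h rfl
  · exact h (Finset.pair_comm _ _)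

/-- The matrix Z + εΣ equals I - τ(L - (ε/τ)Σ), and t ↦ 1 - τt reverses order. -/
theorem argminMSupLE_eq_argmaxMPLSE {V : Type*} [Fintype V] [DecidableEq V] [Nonempty V]
    (G : SimpleGraph V) [DecidableRel G.Adj] (k : ℕ) {τ : ℝ} (hτ : 0 < τ) (ε : ℝ) :
    argminMSupLE G k τ ε = argmaxMPLSE G k (ε / τ) := by
  have hH : ∀ S : Finset V, (perturbedLaplacian G (ε / τ) S).IsHermitian := by
    intro S
    refine (SimpleGraph.isHermitian_lapMatrix ℝ G).sub (Matrix.IsHermitian.smul ?_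
      (IsSelfAdjoint.all _))
    rw [Matrix.IsHermitian, Matrix.conjTranspose_sum]
    exact Finset.sum_congr rfl fun j _ => (unitDiag_isHermitian j).eq
  have h : ∀ S : Finset V, lambdaMax (superStochastic G τ ε S) =
      1 - τ * lambdaMin (perturbedLaplacian G (ε / τ) S) := by
    intro S
    rw [← lambdaMax_one_sub_smul (hH S) hτ]
    congr 1
    rw [superStochastic, stochasticMatrix, perturbedLaplacian, smul_sub, smul_smul,
      mul_div_cancel₀ _ hτ.ne']
    abel
  ext S
  simp only [argminMSupLE, argmaxMPLSE, h, sub_le_sub_iff_left, mul_le_mul_iff_right₀ hτ]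

variable {n : ℕ} [DecidableRel (SimpleGraph.pathGraph n).Adj]

theorem lambdaMin_perturbedLaplacian_pair {p q : Fin n} (hpq : p ≠ q) (ε : ℝ) :
    lambdaMin (perturbedLaplacian (SimpleGraph.pathGraph n) ε {p, q}) =
      twoPortLambdaMin n p q (-ε) := by
  rw [perturbedLaplacian, twoPortLambdaMin, Finset.sum_pair hpq, smul_add, neg_smul, neg_smul]
  congr 1
  abel

theorem argmaxMPLSE_eq_singleton {p₁ p₂ : Fin n} (hne : p₁ ≠ p₂) {ε : ℝ}
    (h : ∀ p q : Fin n, s(p, q) ≠ s(p₁, p₂) →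
      twoPortLambdaMin n p q (-ε) < twoPortLambdaMin n p₁ p₂ (-ε)) :
    argmaxMPLSE (SimpleGraph.pathGraph n) 2 ε = {{p₁, p₂}} := by
  have := setOf_card_forall_le_eq_singleton (k := 2) (S₀ := {p₁, p₂})
    (F := fun S => -lambdaMin (perturbedLaplacian (SimpleGraph.pathGraph n) ε S))
    (Finset.card_pair hne) (by
      intro S hS hS0
      obtain ⟨p, q, hpq, rfl⟩ := Finset.card_eq_two.1 hS
      rw [lambdaMin_perturbedLaplacian_pair hpq, lambdaMin_perturbedLaplacian_pair hne]
      exact neg_lt_neg (h p q (mk_ne_mk_of_pair_ne hS0)))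
  simp only [neg_le_neg_iff] at this
  exact this

theorem argminMSubLE_eq_singleton {a : ℕ} (ha : 0 < a) (hn : n = 4 * a + 2) {p₁ p₂ : Fin n}
    (h₁ : (p₁ : ℕ) = a) (h₂ : (p₂ : ℕ) = 3 * a + 1) {τ : ℝ} (hτ : 0 < τ) :
    argminMSubLE (SimpleGraph.pathGraph n) 2 τ = {{p₁, p₂}} := by
  have hne : p₁ ≠ p₂ := fun h => by rw [h] at h₁; omega
  have hnonempty : ∀ S : Finset (Fin n), S.card = 2 → Nonempty {i : Fin n // i ∉ S} := by
    intro S hS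
    by_contra hemp
    have hall : S = Finset.univ := Finset.eq_univ_of_forall fun i => by
      by_contra hi
      exact hemp ⟨⟨i, hi⟩⟩
    rw [hall, Finset.card_univ, Fintype.card_fin] at hS
    omega
  refine setOf_card_forall_le_eq_singleton (Finset.card_pair hne) fun S hS hS0 => ?_
  have hle : lambdaMax (subStochastic (SimpleGraph.pathGraph n) τ {p₁, p₂}) ≤
      1 - τ * (2 - 2 * Real.cos (Real.pi / (2 * a + 1))) := by
    obtain ⟨v, hv0, hv⟩ := exists_center_grounded_eigenvector ha hn
    have := hnonempty _ (Finset.card_pair hne)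
    have hnot : ∀ i : Fin n, i ∉ ({p₁, p₂} : Finset (Fin n)) →
        (i : ℕ) ≠ a ∧ (i : ℕ) ≠ 3 * a + 1 := by
      intro i hi
      simp only [Finset.mem_insert, Finset.mem_singleton, not_or, Fin.ext_iff, h₁, h₂] at hi
      exact hi
    refine lambdaMax_subStochastic_le _ hτ.le (v := v) ?_ ?_ ?_
    · intro i hi
      simp only [Finset.mem_insert, Finset.mem_singleton, Fin.ext_iff, h₁, h₂] at hi
      exact hv0 i hi
    · exact fun i hi => (hv i (hnot i hi).1 (hnot i hi).2).1
    · exact fun i hi => (hv i (hnot i hi).1 (hnot i hi).2).2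
  have hlt : ∀ p q : Fin n, p < q → ({p, q} : Finset (Fin n)) ≠ {p₁, p₂} →
      1 - τ * (2 - 2 * Real.cos (Real.pi / (2 * a + 1))) <
        lambdaMax (subStochastic (SimpleGraph.pathGraph n) τ {p, q}) := by
    intro p q hpq hS0
    obtain ⟨μ, hμ, v, hvp, hvq, hv0, hv⟩ := exists_grounded_eigenvector ha hn hpq (by
      rintro ⟨e₁, e₂⟩
      exact hS0 (by rw [Fin.ext (e₁.trans h₁.symm), Fin.ext (e₂.trans h₂.symm)]))
    have := hnonempty _ (Finset.card_pair hpq.ne)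
    have hmem := mem_spectrum_subStochastic (SimpleGraph.pathGraph n) τ (S := {p, q}) (v := v)
      (by
        intro i hi
        rcases Finset.mem_insert.1 hi with rfl | hi
        · exact hvp
        · rw [Finset.mem_singleton.1 hi]; exact hvq) hv0 (μ := μ)
      (fun i hi => hv i (fun h => hi (by simp [h])) fun h => hi (by simp [h]))
    have hge := (lambdaMax_isGreatest (subStochastic_isHermitian _ τ _)).2 hmem
    have := mul_lt_mul_of_pos_left hμ hτ
    linarith
  refine hle.trans_lt ?_
  obtain ⟨p, q, hpq, rfl⟩ := Finset.card_eq_two.1 hS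
  rcases lt_or_gt_of_ne hpq with h | h
  · exact hlt p q h hS0
  · rw [Finset.pair_comm] at hS0 ⊢
    exact hlt q p h hS0

theorem eigenvalueAsc_pathGraph {k : ℕ} (hk : k < Fintype.card (Fin n)) :
    eigenvalueAsc (SimpleGraph.isHermitian_lapMatrix ℝ (SimpleGraph.pathGraph n)) ⟨k, hk⟩ =
      2 - 2 * Real.cos (Real.pi * k / n) := by
  have hcard := Fintype.card_fin n
  rw [eigenvalueAsc_eq_of_strictMono _
    (fun k => 2 - 2 * Real.cos (Real.pi * (k : ℕ) / n))]
  · intro k l hkl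
    exact pathEigenvalue_strictMono hkl (l.2.trans_eq hcard)
  · intro k
    have hkn : (k : ℕ) < n := k.2.trans_eq hcard
    refine mem_spectrum_iff_exists_mulVec.2 ⟨_, ?_, lapMatrix_mulVec_pathCos (n := n) k⟩
    intro h
    have := congrFun h ⟨0, by omega⟩
    simp only [Pi.zero_apply, Nat.cast_zero] at this
    exact (pathCos_zero_pos hkn).ne' this

/-- The eigenvalues of the path Laplacian are simple. -/
theorem exists_eq_smul_pathCos {k : ℕ} (hk : k < n) {v : Fin n → ℝ}
    (hv : ((SimpleGraph.pathGraph n).lapMatrix ℝ).mulVec v =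
      (2 - 2 * Real.cos (Real.pi * k / n)) • v) :
    ∃ c : ℝ, ∀ i : Fin n, v i = c * pathCos n k (i : ℕ) := by
  refine ⟨(v ⬝ᵥ fun j : Fin n => pathCos n k (j : ℕ)) / ∑ j : Fin n, pathCos n k (j : ℕ) ^ 2,
    fun i => ?_⟩
  rw [eq_sum_pathCos v i, Finset.sum_eq_single (⟨k, hk⟩ : Fin n)]
  · ring
  · intro l _ hl
    rw [dotProduct_pathCos_eq_zero hv, zero_mul, zero_div]
    rcases lt_or_gt_of_ne (fun h => hl (Fin.ext h) : (l : ℕ) ≠ k) with h | h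
    · exact (pathEigenvalue_strictMono h hk).ne'
    · exact (pathEigenvalue_strictMono h l.2).ne
  · simp

/-- The cosine vanishes when 2i + 1 is an odd multiple of 2a + 1; being positive and below 4(2a +
1), it can only be one or three times it. -/
theorem pathCos_two_eq_zero_iff {a i : ℕ} (hi : i < 4 * a + 2) :
    pathCos (4 * a + 2) 2 i = 0 ↔ i = a ∨ i = 3 * a + 1 := by
  have hy : (4 * (a : ℝ) + 2) ≠ 0 := by positivity
  have hpi := Real.pi_ne_zero
  rw [pathCos, Real.cos_eq_zero_iff]
  have hiff : ∀ k : ℤ, Real.pi * (2 : ℕ) * ((i : ℝ) + 1 / 2) / ((4 * a + 2 : ℕ) : ℝ) =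
      (2 * k + 1) * Real.pi / 2 ↔ 2 * (i : ℤ) + 1 = (2 * k + 1) * (2 * a + 1) := by
    intro k
    rw [← Int.cast_inj (α := ℝ)]
    push_cast
    rw [div_eq_div_iff hy two_ne_zero]
    constructor
    · intro h
      have : Real.pi * (2 * ((2 * (i : ℝ) + 1) - (2 * k + 1) * (2 * a + 1))) = 0 := by linarith
      have := (mul_eq_zero.1 this).resolve_left hpi
      linarith
    · intro h
      linear_combination (2 * Real.pi) * h
  simp only [hiff]
  constructor
  · rintro ⟨k, hk⟩
    have hi' : (i : ℤ) < 4 * a + 2 := by exact_mod_cast hi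
    have k0 : 0 ≤ k := by
      by_contra hneg
      have : 2 * k + 1 ≤ -1 := by omega
      nlinarith
    have k1 : k ≤ 1 := by
      by_contra hgt
      have : 5 ≤ 2 * k + 1 := by omega
      nlinarith
    have : k = 0 ∨ k = 1 := by omega
    rcases this with rfl | rfl
    · left; omega
    · right; omega
  · rintro (rfl | rfl)
    · exact ⟨0, by ring⟩
    · exact ⟨1, by push_cast; ring⟩

omit [DecidableRel (SimpleGraph.pathGraph n).Adj] in
theorem sum_Icc_two_eq_sum_range (f : ℕ → ℝ) :
    ∑ j ∈ Finset.Icc 2 n, f j = ∑ k ∈ Finset.range (n - 1), f (k + 2) := by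
  have h : Finset.Icc 2 n = Finset.Ico 2 (n + 1) := by
    ext j; simp
  rw [h, Finset.sum_Ico_eq_sum_range]
  exact Finset.sum_congr (by congr 1) fun k _ => by rw [add_comm]

omit [DecidableRel (SimpleGraph.pathGraph n).Adj] in
theorem sum_Icc_one_eq_sum_range (f : ℕ → ℝ) :
    ∑ j ∈ Finset.Icc 1 n, f j = ∑ k ∈ Finset.range n, f (k + 1) := by
  have h : Finset.Icc 1 n = Finset.Ico 1 (n + 1) := by
    ext j; simp
  rw [h, Finset.sum_Ico_eq_sum_range]
  exact Finset.sum_congr (by congr 1) fun k _ => by rw [add_comm]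

/-- The center sits at a + 1/2 = n/4 and 3a + 3/2 = 3n/4 in the cosine variable, whence the angles
with denominator 4. -/
theorem twoPortCoeff_center_eq_sum {a : ℕ} (hn : n = 4 * a + 2) :
    twoPortCoeff n a (3 * a + 1) = -(1 / (4 * (n : ℝ)) * ∑ j ∈ Finset.Icc 2 n,
      (Real.cos (Real.pi * ((j : ℝ) - 1) / 4) + Real.cos (3 * Real.pi * ((j : ℝ) - 1) / 4)) ^ 2 /
        (Real.sin (Real.pi * ((j : ℝ) - 1) / (2 * n)) ^ 2 *
          ∑ p ∈ Finset.Icc 1 n,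
            Real.cos (Real.pi * ((j : ℝ) - 1) * ((p : ℝ) - 1 / 2) / n) ^ 2)) := by
  have hy : (4 * (a : ℝ) + 2) ≠ 0 := by positivity
  have hn' : (n : ℝ) = 4 * a + 2 := by rw [hn]; push_cast; ring
  rw [show twoPortCoeff n a (3 * a + 1) = twoPortCoeff n (⟨a, by omega⟩ : Fin n)
    (⟨3 * a + 1, by omega⟩ : Fin n) from rfl, twoPortCoeff_eq_sum_pathCos,
    sum_Icc_two_eq_sum_range]
  congr 2
  refine Finset.sum_congr rfl fun k _ => ?_
  rw [sum_Icc_one_eq_sum_range]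
  have e0 : ((k + 2 : ℕ) : ℝ) - 1 = (k + 1 : ℕ) := by push_cast; ring
  rw [e0]
  congr 1
  · congr 2
    · rw [pathCos, hn']
      congr 1
      field_simp
      ring
    · rw [pathCos, hn']
      congr 1
      push_cast
      field_simp
      ring
  · congr 1
    refine Finset.sum_congr rfl fun j _ => ?_
    rw [pathCos]
    congr 3
    push_cast
    ring

end PathCenter

end KCenter

end

theorem mainTheorem2 (n : ℕ) [DecidableRel (SimpleGraph.pathGraph n).Adj]
    (hn : 2 < n) (heven : Even n) (hodd : Odd (n / 2)) :
    ∃ p₁ p₂ : Fin n,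
      -- nodes are labelled `1, …, n`, the node `p : Fin n` having the label `p + 1`
      ((p₁ : ℕ) : ℝ) + 1 = ((n : ℝ) + 2) / 4 ∧
      ((p₂ : ℕ) : ℝ) + 1 = (3 * (n : ℝ) + 2) / 4 ∧
      -- second-order expansion of the smallest eigenvalue, and its maximum
      (∃ β : Fin n → Fin n → ℝ,
        (∀ p q : Fin n,
          (fun ε : ℝ => KCenter.twoPortLambdaMin n p q ε - (2 * ε / n + β p q * ε ^ 2))
            =O[𝓝 0] (fun ε : ℝ => ε ^ 3)) ∧
        (∀ p q : Fin n, s(p, q) ≠ s(p₁, p₂) → β p q < β p₁ p₂) ∧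
        β p₁ p₂ = -(((n : ℝ) ^ 2 - 4) / (12 * (n : ℝ) ^ 2)) ∧
        β p₁ p₂ = -(1 / (4 * (n : ℝ)) * ∑ j ∈ Finset.Icc 2 n,
          (Real.cos (Real.pi * ((j : ℝ) - 1) / 4) +
              Real.cos (3 * Real.pi * ((j : ℝ) - 1) / 4)) ^ 2 /
            (Real.sin (Real.pi * ((j : ℝ) - 1) / (2 * n)) ^ 2 *
              ∑ p ∈ Finset.Icc 1 n,
                Real.cos (Real.pi * ((j : ℝ) - 1) * ((p : ℝ) - 1 / 2) / n) ^ 2))) ∧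
      (∀ᶠ ε : ℝ in 𝓝[≠] 0, ∀ p q : Fin n, s(p, q) ≠ s(p₁, p₂) →
        KCenter.twoPortLambdaMin n p q ε < KCenter.twoPortLambdaMin n p₁ p₂ ε) ∧
      -- the two nodes are the unique 2-center in each of the three senses
      (∀ᶠ ε : ℝ in 𝓝[≠] 0,
        KCenter.argmaxMPLSE (SimpleGraph.pathGraph n) 2 ε = {{p₁, p₂}}) ∧
      (∀ τ : ℝ, 0 < τ → τ < 1 / ((SimpleGraph.pathGraph n).maxDegree : ℝ) →
        KCenter.argminMSubLE (SimpleGraph.pathGraph n) 2 τ = {{p₁, p₂}}) ∧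
      (∀ τ : ℝ, 0 < τ → τ < 1 / ((SimpleGraph.pathGraph n).maxDegree : ℝ) →
        ∀ᶠ ε : ℝ in 𝓝[>] 0,
          KCenter.argminMSupLE (SimpleGraph.pathGraph n) 2 τ ε = {{p₁, p₂}}) ∧
      -- the zeros of the third Laplacian eigenvector
      (∀ v : Fin n → ℝ, v ≠ 0 →
        ((SimpleGraph.pathGraph n).lapMatrix ℝ).mulVec v =
          KCenter.eigenvalueAsc (SimpleGraph.isHermitian_lapMatrix ℝ (SimpleGraph.pathGraph n))
            ⟨2, (Fintype.card_fin n).symm ▸ hn⟩ • v →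
        ∀ j : Fin n, v j = 0 ↔ j = p₁ ∨ j = p₂) := by
  obtain ⟨b, hb⟩ := hodd
  obtain ⟨a, ha, hna⟩ : ∃ a, 0 < a ∧ n = 4 * a + 2 := by
    obtain ⟨m, hm⟩ := heven
    exact ⟨b, by omega, by omega⟩
  have hn' : (n : ℝ) = 4 * a + 2 := by rw [hna]; push_cast; ring
  set p₁ : Fin n := ⟨a, by omega⟩ with hp₁
  set p₂ : Fin n := ⟨3 * a + 1, by omega⟩ with hp₂
  have hne : p₁ ≠ p₂ := fun h => by
    have := congrArg Fin.val h
    simp only [hp₁, hp₂] at this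
    omega
  have : Nonempty (Fin n) := ⟨p₁⟩
  have hβ : ∀ p q : Fin n, s(p, q) ≠ s(p₁, p₂) →
      KCenter.twoPortCoeff n p q < KCenter.twoPortCoeff n p₁ p₂ := by
    intro p q h
    rw [Ne, Sym2.eq_iff, not_or] at h
    have := KCenter.twoPortCoeff_lt (p := p) (q := q) ha
      (fun h' => h.1 ⟨Fin.ext h'.1, Fin.ext h'.2⟩) (fun h' => h.2 ⟨Fin.ext h'.1, Fin.ext h'.2⟩)
    rwa [← hna] at this
  have hev : ∀ᶠ ε : ℝ in 𝓝[≠] 0, ∀ p q : Fin n, s(p, q) ≠ s(p₁, p₂) →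
      KCenter.twoPortLambdaMin n p q ε < KCenter.twoPortLambdaMin n p₁ p₂ ε := by
    refine eventually_all.2 fun p => eventually_all.2 fun q => ?_
    by_cases h : s(p, q) = s(p₁, p₂)
    · exact Eventually.of_forall fun ε h' => absurd h h'
    · have hexp : ∀ p q : Fin n, (fun ε : ℝ => KCenter.twoPortLambdaMin n p q ε -
          (2 / (n : ℝ) * ε + KCenter.twoPortCoeff n p q * ε ^ 2)) =O[𝓝 0]
            (fun ε : ℝ => ε ^ 3) := by
        intro p q
        refine (KCenter.twoPortLambdaMin_isBigO p q).congr_left fun ε => ?_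
        ring
      filter_upwards [KCenter.eventually_lt_of_expansion (hexp p q) (hexp p₁ p₂) (hβ p q h)]
        with ε hε _
      exact hε
  -- MPLSE subtracts the perturbation, so the two-sided comparison is used at -ε.
  have hneg : Tendsto (fun ε : ℝ => -ε) (𝓝[≠] 0) (𝓝[≠] 0) := by
    refine tendsto_nhdsWithin_iff.2 ⟨?_, ?_⟩
    · have : Tendsto (fun ε : ℝ => -ε) (𝓝 0) (𝓝 (-0)) := tendsto_id.neg
      rw [neg_zero] at this
      exact this.mono_left nhdsWithin_le_nhds
    · filter_upwards [self_mem_nhdsWithin] with ε hε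
      simpa using hε
  have hmax : ∀ᶠ ε : ℝ in 𝓝[≠] 0,
      KCenter.argmaxMPLSE (SimpleGraph.pathGraph n) 2 ε = {{p₁, p₂}} := by
    filter_upwards [hneg.eventually hev] with ε hε
    exact KCenter.argmaxMPLSE_eq_singleton hne hε
  refine ⟨p₁, p₂, ?_, ?_, ⟨fun p q => KCenter.twoPortCoeff n p q,
    fun p q => KCenter.twoPortLambdaMin_isBigO p q, hβ, ?_, ?_⟩, hev, hmax, ?_, ?_, ?_⟩
  · rw [hn', hp₁]; ring
  · rw [hn', hp₂]; push_cast; ring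
  · have := KCenter.twoPortCoeff_center a
    rwa [← hna] at this
  · exact KCenter.twoPortCoeff_center_eq_sum hna
  · exact fun τ hτ _ => KCenter.argminMSubLE_eq_singleton ha hna rfl rfl hτ
  · intro τ hτ _
    have hdiv : Tendsto (fun ε : ℝ => ε / τ) (𝓝[>] 0) (𝓝[≠] 0) := by
      refine tendsto_nhdsWithin_iff.2 ⟨?_, ?_⟩
      · have : Tendsto (fun ε : ℝ => ε / τ) (𝓝 0) (𝓝 (0 / τ)) := tendsto_id.div_const τ
        rw [zero_div] at this
        exact this.mono_left nhdsWithin_le_nhds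
      · filter_upwards [self_mem_nhdsWithin] with ε hε
        exact (div_pos hε hτ).ne'
    filter_upwards [hdiv.eventually hmax] with ε hε
    rw [KCenter.argminMSupLE_eq_argmaxMPLSE _ _ hτ, hε]
  · intro v hv h j
    rw [KCenter.eigenvalueAsc_pathGraph] at h
    obtain ⟨c, hc⟩ := KCenter.exists_eq_smul_pathCos hn h
    have hc0 : c ≠ 0 := by
      rintro rfl
      exact hv (funext fun i => by rw [hc, zero_mul, Pi.zero_apply])
    have hzero := KCenter.pathCos_two_eq_zero_iff (a := a) (i := j) (hna ▸ j.2)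
    rw [← hna] at hzero
    rw [hc, mul_eq_zero, or_iff_right hc0, hzero, Fin.ext_iff, Fin.ext_iff]
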